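/- \textbf{Setting.} Let $S\subset\mathbb R^D$ be a finite data set of doubling dimension at most $d$, i.e. for every closed ball $B(y,\rho)\subset\mathbb R^D$ the set $B(y,\rho)\cap S$ can be covered by $2^d$ closed balls of radius $\rho/2$. The radius of a finite set of points is the radius of its smallest enclosing ball. An RPTree-Max on $S$ is the following random binary tree. The root cell is $S$. A cell $C$ (identified with the set of data points in it) is split as follows: pick a direction $v\sim N(0,\frac1D I_D)$, pick an arbitrary data point $p\in C$ (by any fixed rule that may depend on the node and on $C$), put $\tilde\Delta=\max\{\|p-y\| : y\in C\}$, pick $\delta$ uniformly at random in $[-1,1]\cdot 6\tilde\Delta/\sqrt D$, and send $z\in C$ to the left child if $z\cdot v<\mathrm{median}(\{z'\cdot v : z'\in C\})+\delta$ and to the right child otherwise. The random choices at different nodes, and the two choices at one node, are independent. The tree is continued indefinitely (so it contains every tree obtained from it by a stopping rule). \textbf{Theorem.} There is an absolute constant $c>0$ with the following property. Let $d\ge 2$, let $S\subset\mathbb R^D$ be a finite data set of doubling dimension at most $d$, and let $r>0$ and $R\ge 2r$. For any fixed closed ball $B=B(x,R)\subset\mathbb R^D$, with probability greater than $1/2$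 over the construction of the RPTree-Max on $S$, every family of pairwise disjoint cells of the tree, each of radius greater than $r$ and each containing a data point that lies in $B$, has at most $$\left(\frac Rr\right)^{c\,d\,\log d\,\log (dR/r)}$$ members. -/

import Mathlib

open MeasureTheory ProbabilityTheory
open scoped NNReal ENNReal

namespace RPTreeMax

/-- `S` has doubling dimension at most `d`: every ball `B` of radius `ρ` is such that `B ∩ S` can be
covered by `2 ^ d` balls of radius `ρ / 2` (all balls are closed, their centres lie anywhere in the
ambient space). -/
def DoublingDimLE {D : ℕ} (S : Set (EuclideanSpace ℝ (Fin D))) (d : ℕ) : Prop :=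
  ∀ (y : EuclideanSpace ℝ (Fin D)) (ρ : ℝ), 0 < ρ →
    ∃ T : Finset (EuclideanSpace ℝ (Fin D)), T.card ≤ 2 ^ d ∧
      Metric.closedBall y ρ ∩ S ⊆ ⋃ t ∈ T, Metric.closedBall t (ρ / 2)

/-- The radius of a finite point set: the radius of its smallest enclosing ball. -/
noncomputable def radius {D : ℕ} (C : Finset (EuclideanSpace ℝ (Fin D))) : ℝ :=
  sInf {ρ : ℝ | 0 ≤ ρ ∧ ∃ y : EuclideanSpace ℝ (Fin D), ∀ z ∈ C, dist z y ≤ ρ}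

/-- The law `N(0, (1/D) I_D)` of the random direction. -/
noncomputable def directionLaw (D : ℕ) : Measure (EuclideanSpace ℝ (Fin D)) :=
  (Measure.pi fun _ : Fin D => gaussianReal 0 (1 / (D : ℝ≥0))).map (WithLp.toLp 2)

/-- The uniform distribution on `[-1, 1]`. -/
noncomputable def offsetLaw : Measure ℝ :=
  ProbabilityTheory.cond volume (Set.Icc (-1 : ℝ) 1)

instance (D : ℕ) : IsProbabilityMeasure (directionLaw D) :=
  Measure.isProbabilityMeasure_map (by fun_prop)

instance : IsProbabilityMeasure offsetLaw :=
  cond_isProbabilityMeasure_of_finite (by simp) (by simp)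

/-- The random choices made in building a tree: every node, named by the list of the left/right
turns that lead to it (the latest turn first), has a direction and a number in `[-1, 1]`. -/
abbrev Choices (D : ℕ) : Type := List Bool → EuclideanSpace ℝ (Fin D) × ℝ

/-- The law of the random choices: the directions and the offsets of all nodes are independent. -/
noncomputable def choicesLaw (D : ℕ) : Measure (Choices D) :=
  Measure.infinitePi fun _ : List Bool => (directionLaw D).prod offsetLaw

/-- The median of the numbers `z · v`, `z ∈ C` (with multiplicity): the midpoint between the lower
and the upper median. -/
noncomputable def median {D : ℕ} (C : Finset (EuclideanSpace ℝ (Fin D)))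
    (v : EuclideanSpace ℝ (Fin D)) : ℝ :=
  (sInf {t : ℝ | C.card ≤ 2 * (C.filter fun z => inner ℝ z v ≤ t).card} +
    sSup {t : ℝ | C.card ≤ 2 * (C.filter fun z => t ≤ inner ℝ z v).card}) / 2

/-- The estimate `max {‖p - y‖ : y ∈ C}` of the radius of `C`. -/
noncomputable def radiusEstimate {D : ℕ} (p : EuclideanSpace ℝ (Fin D))
    (C : Finset (EuclideanSpace ℝ (Fin D))) : ℝ :=
  ((C.sup fun y => nndist p y : ℝ≥0) : ℝ)

/-- The split point of the cell `C`, with pivot `p ∈ C`, direction `v` and offset `u ∈ [-1, 1]`. -/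
noncomputable def splitPoint {D : ℕ} (C : Finset (EuclideanSpace ℝ (Fin D)))
    (p v : EuclideanSpace ℝ (Fin D)) (u : ℝ) : ℝ :=
  median C v + u * (6 * radiusEstimate p C / Real.sqrt D)

/-- The children of a cell: left (`true`) are the points `z` with `z · v < t`, right (`false`) the
others. -/
noncomputable def child {D : ℕ} (C : Finset (EuclideanSpace ℝ (Fin D)))
    (v : EuclideanSpace ℝ (Fin D)) (t : ℝ) : Bool → Finset (EuclideanSpace ℝ (Fin D))
  | true => C.filter fun z => inner ℝ z v < t
  | false => C.filter fun z => ¬ inner ℝ z v < t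

/-- The cell (its set of data points) at each node of the tree built on the data set `S`; `pivot`
selects the point of a cell that is used for estimating the radius of the cell. -/
noncomputable def cell {D : ℕ} (S : Finset (EuclideanSpace ℝ (Fin D)))
    (pivot : List Bool → Finset (EuclideanSpace ℝ (Fin D)) → EuclideanSpace ℝ (Fin D))
    (ω : Choices D) : List Bool → Finset (EuclideanSpace ℝ (Fin D))
  | [] => S
  | b :: w =>
    child (cell S pivot ω w) (ω w).1
      (splitPoint (cell S pivot ω w) (pivot w (cell S pivot ω w)) (ω w).1 (ω w).2) b

end RPTreeMax

/-!
The proof treats the tree as a branching process of cells and runs one Lyapunov function over it.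

*One split.* The projection of a vector `z` to the random direction is a Gaussian of standard
deviation `‖z‖ / √D` (`map_inner_directionLaw`). By chaining, a ball of radius `ρ` in a doubling set
projects to an interval of expected length `O(d ρ / √D)` (`integral_projWidth_le`), while the split
point is spread over an interval of length of the order `Δ / √D`, where `Δ` is the radius of the
cell. So a split cuts the ball with probability `O(d ρ / Δ)` (`nodeLaw_cut_le`). On the other hand,
since the median of the projected cell is close to the projection of the pivot, two balls of radius
`Δ / O(d)` at distance about `Δ / 2` are separated with probability bounded below. Hence the expected
number of children that meet both balls is smaller than `1` by a constant
(`integral_meetsBoth_children_le`).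

*The potential.* Cover `S` by the balls of radius `Δ / O(d)` around a net. A cell of radius in
`(Δ / 2, Δ]` meets `d ^ O(d)` of them, and the number `h` of the pairs of distant balls it meets is at
least `1`, at most `d ^ O(d)`, and contracts in expectation when the cell is split
(`exists_potential`).

*The Lyapunov function.* For a cell of radius at most `poly(d) R`, the potential `h`, multiplied by a
factor `d ^ O(d)` per scale, bounds the expected number of all descendants of radius greater than
`r`; there are `O(log (d R / r))` scales. For larger cells one only has to exclude that the ball `B`
is cut at all. A cell stays within its scale for `O(log h) = O(d log d)` steps, since `log h` decreases
by a constant per step in expectation, and the probabilities of cutting `B` form a geometric series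
over the scales, whose sum is small from radius `poly(d) R` on. Both estimates are one inequality
(`drift`) for a function `lyapunov` that is at most `1 / 4`: the expected sum of the function over the
two children, plus the cost of the node, is at most the value at the node.

*The tree.* A cell is independent of the choices at its node (`indepFun_cell`), so that the drift
inequality sums up over the tree, and the total cost has expectation at most `1 / 4`. If the total
cost is less than `1`, then `B` is not cut at any large cell, so disjoint cells that meet `B` are small
unless there is only one of them, and the number of small ones is at most `cellBound`
(`card_le_cellBound`). It remains to estimate `cellBound` (`cellBound_le`).
-/

namespace RPTreeMax

/-! ### Gaussian projections -/

/-- A fixed vector, projected to the random direction, is a centred Gaussian of variance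
`‖z‖ ^ 2 / D`. -/
lemma map_inner_directionLaw {D : ℕ} (z : EuclideanSpace ℝ (Fin D)) :
    (directionLaw D).map (fun v => inner ℝ z v) = gaussianReal 0 (‖z‖₊ ^ 2 / (D : ℝ≥0)) := by
  apply Measure.ext_of_charFun
  ext t
  rw [charFun_apply_real, integral_map (by fun_prop) (by fun_prop)]
  have h : ∫ v, Complex.exp (t * (inner ℝ z v : ℝ) * Complex.I) ∂(directionLaw D)
      = charFun (directionLaw D) (t • z) := by
    rw [charFun_apply]
    congr 1
    ext v
    rw [real_inner_smul_right, real_inner_comm]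
    push_cast
    rfl
  rw [h, directionLaw]
  have := charFun_pi (μ := fun _ : Fin D => gaussianReal 0 (1 / (D : ℝ≥0))) (t • z)
  rw [this]
  simp_rw [charFun_gaussianReal]
  rw [← Complex.exp_sum]
  congr 1
  simp only [PiLp.smul_apply, smul_eq_mul, Complex.ofReal_mul, Complex.ofReal_zero, mul_zero,
    zero_mul, zero_sub, Finset.sum_neg_distrib]
  congr 1
  have hz : (‖z‖ : ℂ) ^ 2 = ∑ i, (z i : ℂ) ^ 2 := by
    have := EuclideanSpace.real_norm_sq_eq z
    exact_mod_cast this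
  push_cast
  rw [hz, Finset.sum_div, Finset.sum_mul, Finset.sum_div]
  refine Finset.sum_congr rfl fun i _ => ?_
  ring

lemma gaussianReal_abs_pow_le (v : ℝ≥0) (p : ℕ) :
    Integrable (fun x : ℝ => |x| ^ p) (gaussianReal 0 v) ∧
      ∫ x, |x| ^ p ∂(gaussianReal 0 v) ≤ 4 * p.factorial * Real.sqrt v ^ p := by
  have hint : Integrable (fun x : ℝ => |x| ^ p) (gaussianReal 0 v) := by
    have := (memLp_id_gaussianReal (μ := 0) (v := v) (p : ℝ≥0)).integrable_norm_pow'
    simpa using this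
  refine ⟨hint, ?_⟩
  rcases eq_or_ne v 0 with rfl | hv
  · rcases Nat.eq_zero_or_pos p with rfl | hp
    · simp
    · simp [hp.ne']
  set s := Real.sqrt v with hs
  have hv0 : (0 : ℝ) < v := by positivity
  have hs0 : 0 < s := Real.sqrt_pos.2 hv0
  have hss : s ^ 2 = v := Real.sq_sqrt hv0.le
  have hexp : ∀ c : ℝ, c ^ 2 = 1 →
      ∫ x, Real.exp (c / s * x) ∂(gaussianReal 0 v) = Real.exp (1 / 2) := by
    intro c hc
    have := congrFun (mgf_id_gaussianReal (μ := 0) (v := v)) (c / s)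
    simp only [mgf, id] at this
    rw [this]
    congr 1
    rw [div_pow, hc, hss]
    field_simp
    ring
  have hpt : ∀ x : ℝ, |x| ^ p ≤
      s ^ p * p.factorial * (Real.exp (1 / s * x) + Real.exp (-1 / s * x)) := by
    intro x
    have h1 : (|x| / s) ^ p / p.factorial ≤ Real.exp (|x| / s) :=
      Real.pow_div_factorial_le_exp _ (by positivity) p
    have h2 : Real.exp (|x| / s) ≤ Real.exp (1 / s * x) + Real.exp (-1 / s * x) := by
      rcases abs_cases x with ⟨h, _⟩ | ⟨h, _⟩
      · rw [h, show x / s = 1 / s * x by ring]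
        linarith [Real.exp_pos (-1 / s * x)]
      · rw [h, show -x / s = -1 / s * x by ring]
        linarith [Real.exp_pos (1 / s * x)]
    have h3 := h1.trans h2
    rw [div_le_iff₀ (by positivity), div_pow, div_le_iff₀ (by positivity)] at h3
    linarith
  have hi1 := integrable_exp_mul_gaussianReal (μ := 0) (v := v) (1 / s)
  have hi2 := integrable_exp_mul_gaussianReal (μ := 0) (v := v) (-1 / s)
  calc ∫ x, |x| ^ p ∂(gaussianReal 0 v)
      ≤ ∫ x, s ^ p * p.factorial * (Real.exp (1 / s * x) + Real.exp (-1 / s * x))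
          ∂(gaussianReal 0 v) :=
        integral_mono hint ((hi1.add hi2).const_mul _) hpt
    _ = s ^ p * p.factorial * (2 * Real.exp (1 / 2)) := by
        rw [integral_const_mul, integral_add hi1 hi2, hexp 1 (by norm_num),
          hexp (-1) (by norm_num)]
        ring
    _ ≤ s ^ p * p.factorial * 4 := by
        have : Real.exp (1 / 2) ≤ 2 := by
          rw [← Real.le_log_iff_exp_le (by norm_num)]
          linarith [Real.log_two_gt_d9]
        gcongr
        linarith
    _ = 4 * p.factorial * s ^ p := by ring

/-- Chebyshev's inequality for a centred Gaussian; strict, so that it holds for variance `0`. -/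
lemma gaussianReal_abs_gt_le (v : ℝ≥0) {t : ℝ} (ht : 0 < t) :
    (gaussianReal 0 v).real {x | t * Real.sqrt v < |x|} ≤ 1 / t ^ 2 := by
  rcases eq_or_ne v 0 with rfl | hv
  · simpa [measureReal_def] using sq_nonneg t
  have hv0 : (0 : ℝ) < v := by positivity
  have hs0 : 0 < Real.sqrt v := Real.sqrt_pos.2 hv0
  have h := meas_ge_le_variance_div_sq (μ := gaussianReal 0 v) (X := id)
    (memLp_id_gaussianReal' 2 (by simp)) (c := t * Real.sqrt v) (by positivity)
  rw [variance_id_gaussianReal, mul_pow, Real.sq_sqrt hv0.le] at h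
  rw [measureReal_def]
  refine ENNReal.toReal_le_of_le_ofReal (by positivity) ?_
  refine (measure_mono ?_).trans (h.trans_eq ?_)
  · intro x hx
    simpa [integral_id_gaussianReal] using le_of_lt hx
  · congr 1
    field_simp

/-- A Gaussian puts little mass on short intervals around its mean. -/
lemma gaussianReal_abs_lt_le (v : ℝ≥0) {t : ℝ} (ht : 0 ≤ t) :
    (gaussianReal 0 v).real {x | |x| < t * Real.sqrt v} ≤ t := by
  rcases eq_or_ne v 0 with rfl | hv
  · have : {x : ℝ | |x| < t * Real.sqrt (0 : ℝ≥0)} = ∅ := by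
      ext x; simp
    rw [this]; simpa using ht
  have hv0 : (0 : ℝ) < v := by positivity
  have hs0 : 0 < Real.sqrt v := Real.sqrt_pos.2 hv0
  have hset : {x : ℝ | |x| < t * Real.sqrt v} =
      Set.Ioo (-(t * Real.sqrt v)) (t * Real.sqrt v) := by
    ext x; simp [abs_lt]
  rw [hset, measureReal_def, gaussianReal_apply _ hv]
  refine ENNReal.toReal_le_of_le_ofReal ht ?_
  have hbd : ∀ x, gaussianPDF 0 v x ≤ ENNReal.ofReal (1 / (2 * Real.sqrt v)) := by
    intro x
    rw [gaussianPDF_def]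
    apply ENNReal.ofReal_le_ofReal
    rw [gaussianPDFReal_def]
    have h1 : Real.exp (-(x - 0) ^ 2 / (2 * v)) ≤ 1 := by
      rw [Real.exp_le_one_iff]
      apply div_nonpos_of_nonpos_of_nonneg
      · nlinarith [sq_nonneg (x - 0)]
      · positivity
    have h2 : 2 * Real.sqrt v ≤ Real.sqrt (2 * Real.pi * v) := by
      apply Real.le_sqrt_of_sq_le
      rw [mul_pow, Real.sq_sqrt hv0.le]
      nlinarith [Real.pi_gt_three]
    calc (Real.sqrt (2 * Real.pi * v))⁻¹ * Real.exp (-(x - 0) ^ 2 / (2 * v))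
        ≤ (2 * Real.sqrt v)⁻¹ * 1 := by
          apply mul_le_mul _ h1 (Real.exp_pos _).le (by positivity)
          exact inv_anti₀ (by positivity) h2
      _ = 1 / (2 * Real.sqrt v) := by ring
  calc ∫⁻ x in Set.Ioo (-(t * Real.sqrt v)) (t * Real.sqrt v), gaussianPDF 0 v x
      ≤ ∫⁻ x in Set.Ioo (-(t * Real.sqrt v)) (t * Real.sqrt v),
          ENNReal.ofReal (1 / (2 * Real.sqrt v)) := lintegral_mono fun x => hbd x
    _ = ENNReal.ofReal t := by
        rw [lintegral_const, Measure.restrict_apply_univ, Real.volume_Ioo,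
          ← ENNReal.ofReal_mul (by positivity)]
        congr 1
        field_simp
        ring

lemma sqrt_variance_inner {D : ℕ} (z : EuclideanSpace ℝ (Fin D)) :
    Real.sqrt ((‖z‖₊ ^ 2 / (D : ℝ≥0) : ℝ≥0) : ℝ) = ‖z‖ / Real.sqrt D := by
  push_cast
  rw [Real.sqrt_div (by positivity), Real.sqrt_sq (norm_nonneg _)]

lemma integral_abs_inner_pow_le {D : ℕ} (z : EuclideanSpace ℝ (Fin D)) (p : ℕ) :
    Integrable (fun v => |inner ℝ z v| ^ p) (directionLaw D) ∧
      ∫ v, |inner ℝ z v| ^ p ∂(directionLaw D) ≤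
        4 * p.factorial * (‖z‖ / Real.sqrt D) ^ p := by
  have h := gaussianReal_abs_pow_le (‖z‖₊ ^ 2 / (D : ℝ≥0)) p
  rw [← map_inner_directionLaw z, sqrt_variance_inner] at h
  constructor
  · exact (integrable_map_measure (f := fun v => inner ℝ z v) (g := fun x : ℝ => |x| ^ p)
      (by fun_prop) (by fun_prop)).1 h.1
  · rw [← integral_map (φ := fun v => inner ℝ z v) (f := fun x : ℝ => |x| ^ p)
      (by fun_prop) (by fun_prop)]
    exact h.2

lemma directionLaw_abs_inner_gt_le {D : ℕ} (z : EuclideanSpace ℝ (Fin D)) {t : ℝ} (ht : 0 < t) :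
    (directionLaw D).real {v | t * (‖z‖ / Real.sqrt D) < |inner ℝ z v|} ≤ 1 / t ^ 2 := by
  have h := gaussianReal_abs_gt_le (‖z‖₊ ^ 2 / (D : ℝ≥0)) ht
  rw [← map_inner_directionLaw z, sqrt_variance_inner,
    map_measureReal_apply (by fun_prop) (measurableSet_lt (by fun_prop) (by fun_prop))] at h
  exact h

lemma directionLaw_abs_inner_lt_le {D : ℕ} (z : EuclideanSpace ℝ (Fin D)) {t : ℝ} (ht : 0 ≤ t) :
    (directionLaw D).real {v | |inner ℝ z v| < t * (‖z‖ / Real.sqrt D)} ≤ t := by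
  have h := gaussianReal_abs_lt_le (‖z‖₊ ^ 2 / (D : ℝ≥0)) ht
  rw [← map_inner_directionLaw z, sqrt_variance_inner,
    map_measureReal_apply (by fun_prop) (measurableSet_lt (by fun_prop) (by fun_prop))] at h
  exact h

/-! ### Covers and separated sets in a doubling set -/

lemma DoublingDimLE.exists_cover {D d : ℕ} {S : Set (EuclideanSpace ℝ (Fin D))}
    (hS : DoublingDimLE S d) (k : ℕ) (y : EuclideanSpace ℝ (Fin D)) {ρ : ℝ} (hρ : 0 < ρ) :
    ∃ T : Finset (EuclideanSpace ℝ (Fin D)), T.card ≤ 2 ^ (d * k) ∧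
      ∀ z ∈ S, dist z y ≤ ρ → ∃ t ∈ T, dist z t ≤ ρ / 2 ^ k := by
  classical
  induction k with
  | zero => exact ⟨{y}, by simp, fun z _ h => ⟨y, by simp, by simpa using h⟩⟩
  | succ k ih =>
    obtain ⟨T, hT, hcov⟩ := ih
    choose f hf1 hf2 using fun t => hS t (ρ / 2 ^ k) (by positivity)
    refine ⟨T.biUnion f, ?_, ?_⟩
    · calc (T.biUnion f).card ≤ T.card * 2 ^ d :=
            Finset.card_biUnion_le_card_mul _ _ _ fun t _ => hf1 t
        _ ≤ 2 ^ (d * k) * 2 ^ d := by gcongr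
        _ = 2 ^ (d * (k + 1)) := by rw [← pow_add]; ring_nf
    · intro z hz hzy
      obtain ⟨t, ht, hzt⟩ := hcov z hz hzy
      have := hf2 t ⟨Metric.mem_closedBall.2 hzt, hz⟩
      simp only [Set.mem_iUnion, Metric.mem_closedBall] at this
      obtain ⟨t', ht', hzt'⟩ := this
      refine ⟨t', Finset.mem_biUnion.2 ⟨t, ht, ht'⟩, ?_⟩
      rw [pow_succ, ← div_div]
      exact hzt'

/-- A cover by balls centred in the set itself, at the price of doubling the radii. -/
lemma DoublingDimLE.exists_cover_mem {D d : ℕ} {S : Set (EuclideanSpace ℝ (Fin D))}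
    (hS : DoublingDimLE S d) (k : ℕ) (y : EuclideanSpace ℝ (Fin D)) {ρ : ℝ} (hρ : 0 < ρ) :
    ∃ T : Finset (EuclideanSpace ℝ (Fin D)), T.card ≤ 2 ^ (d * k) ∧
      (∀ t ∈ T, t ∈ S ∧ dist t y ≤ ρ) ∧
      ∀ z ∈ S, dist z y ≤ ρ → ∃ t ∈ T, dist z t ≤ 2 * (ρ / 2 ^ k) := by
  classical
  obtain ⟨T, hT, hcov⟩ := hS.exists_cover k y hρ
  let P : EuclideanSpace ℝ (Fin D) → Prop := fun t => ∃ z ∈ S, dist z y ≤ ρ ∧ dist z t ≤ ρ / 2 ^ k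
  let f : EuclideanSpace ℝ (Fin D) → EuclideanSpace ℝ (Fin D) :=
    fun t => if h : P t then h.choose else t
  have hf : ∀ t, P t → f t ∈ S ∧ dist (f t) y ≤ ρ ∧ dist (f t) t ≤ ρ / 2 ^ k := by
    intro t ht
    simp only [f, dif_pos ht]
    exact ht.choose_spec
  refine ⟨(T.filter P).image f, ?_, ?_, ?_⟩
  · exact Finset.card_image_le.trans ((Finset.card_filter_le _ _).trans hT)
  · intro t ht
    obtain ⟨t', ht', rfl⟩ := Finset.mem_image.1 ht
    have := hf t' (Finset.mem_filter.1 ht').2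
    exact ⟨this.1, this.2.1⟩
  · intro z hz hzy
    obtain ⟨t, ht, hzt⟩ := hcov z hz hzy
    have hP : P t := ⟨z, hz, hzy, hzt⟩
    refine ⟨f t, Finset.mem_image_of_mem _ (Finset.mem_filter.2 ⟨ht, hP⟩), ?_⟩
    have := dist_triangle_right z (f t) t
    linarith [(hf t hP).2.2]

lemma DoublingDimLE.card_separated_le {D d : ℕ} {S : Set (EuclideanSpace ℝ (Fin D))}
    (hS : DoublingDimLE S d) (k : ℕ) (y : EuclideanSpace ℝ (Fin D)) {ρ : ℝ} (hρ : 0 < ρ)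
    (A : Finset (EuclideanSpace ℝ (Fin D))) (hAS : ∀ a ∈ A, a ∈ S ∧ dist a y ≤ ρ)
    (hA : ∀ a ∈ A, ∀ b ∈ A, a ≠ b → 2 * (ρ / 2 ^ k) < dist a b) :
    A.card ≤ 2 ^ (d * k) := by
  obtain ⟨T, hT, hcov⟩ := hS.exists_cover k y hρ
  choose! f hf using fun a (ha : a ∈ A) => hcov a (hAS a ha).1 (hAS a ha).2
  refine (Finset.card_le_card_of_injOn f (fun a ha => (hf a ha).1) ?_).trans hT
  intro a ha b hb hab
  by_contra hne
  have h1 := hA a ha b hb hne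
  have h2 := dist_triangle_right a b (f a)
  have h3 := (hf a ha).2
  have h4 := (hf b hb).2
  rw [← hab] at h4
  linarith

/-- Every finite set has a maximal `ρ`-separated subset, and that subset is a `ρ`-net. -/
lemma exists_separated_net {D : ℕ} (S : Finset (EuclideanSpace ℝ (Fin D))) {ρ : ℝ} (hρ : 0 ≤ ρ) :
    ∃ T ⊆ S, (∀ a ∈ T, ∀ b ∈ T, a ≠ b → ρ < dist a b) ∧
      ∀ z ∈ S, ∃ t ∈ T, dist z t ≤ ρ := by
  classical
  let 𝒮 := S.powerset.filter fun T => ∀ a ∈ T, ∀ b ∈ T, a ≠ b → ρ < dist a b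
  have hne : 𝒮.Nonempty := ⟨∅, by simp [𝒮]⟩
  obtain ⟨T, hT, hmax⟩ := Finset.exists_max_image 𝒮 Finset.card hne
  simp only [𝒮, Finset.mem_filter, Finset.mem_powerset] at hT
  refine ⟨T, hT.1, hT.2, fun z hz => ?_⟩
  by_contra! hcon
  have hzT : z ∉ T := fun h => by
    have := hcon z h
    rw [dist_self] at this
    linarith
  have hin : insert z T ∈ 𝒮 := by
    simp only [𝒮, Finset.mem_filter, Finset.mem_powerset]
    refine ⟨Finset.insert_subset hz hT.1, ?_⟩
    intro a ha b hb hab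
    rcases Finset.mem_insert.1 ha with rfl | ha' <;> rcases Finset.mem_insert.1 hb with rfl | hb'
    · exact absurd rfl hab
    · exact hcon b hb'
    · rw [dist_comm]; exact hcon a ha'
    · exact hT.2 a ha' b hb' hab
  have := hmax _ hin
  rw [Finset.card_insert_of_notMem hzT] at this
  omega

/-! ### The width of a projected ball -/

/-- The largest distance, after projection to the direction `v`, of a point of `U` from `z₀`. -/
noncomputable def projWidth {D : ℕ} (U : Finset (EuclideanSpace ℝ (Fin D)))
    (z₀ v : EuclideanSpace ℝ (Fin D)) : ℝ :=
  ((U.sup fun z => ‖(inner ℝ (z - z₀) v : ℝ)‖₊ : ℝ≥0) : ℝ)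

lemma projWidth_nonneg {D : ℕ} (U : Finset (EuclideanSpace ℝ (Fin D)))
    (z₀ v : EuclideanSpace ℝ (Fin D)) : 0 ≤ projWidth U z₀ v := NNReal.coe_nonneg _

lemma projWidth_le_iff {D : ℕ} {U : Finset (EuclideanSpace ℝ (Fin D))}
    {z₀ v : EuclideanSpace ℝ (Fin D)} {a : ℝ} (ha : 0 ≤ a) :
    projWidth U z₀ v ≤ a ↔ ∀ z ∈ U, |inner ℝ (z - z₀) v| ≤ a := by
  lift a to ℝ≥0 using ha
  rw [projWidth, NNReal.coe_le_coe, Finset.sup_le_iff]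
  refine forall₂_congr fun z _ => ?_
  rw [← NNReal.coe_le_coe, coe_nnnorm, Real.norm_eq_abs]

lemma abs_inner_le_projWidth {D : ℕ} {U : Finset (EuclideanSpace ℝ (Fin D))}
    {z z₀ v : EuclideanSpace ℝ (Fin D)} (hz : z ∈ U) :
    |inner ℝ (z - z₀) v| ≤ projWidth U z₀ v :=
  (projWidth_le_iff (projWidth_nonneg _ _ _)).1 le_rfl z hz

@[fun_prop]
lemma continuous_projWidth {D : ℕ} (U : Finset (EuclideanSpace ℝ (Fin D)))
    (z₀ : EuclideanSpace ℝ (Fin D)) : Continuous (projWidth U z₀) := by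
  unfold projWidth
  refine NNReal.continuous_coe.comp ?_
  exact Continuous.finset_sup_apply fun z _ => by fun_prop

@[fun_prop]
lemma measurable_projWidth {D : ℕ} (U : Finset (EuclideanSpace ℝ (Fin D)))
    (z₀ : EuclideanSpace ℝ (Fin D)) : Measurable (projWidth U z₀) :=
  (continuous_projWidth U z₀).measurable

lemma projWidth_pow_le_sum {D : ℕ} (U : Finset (EuclideanSpace ℝ (Fin D)))
    (z₀ v : EuclideanSpace ℝ (Fin D)) {p : ℕ} (hp : p ≠ 0) :
    projWidth U z₀ v ^ p ≤ ∑ z ∈ U, |inner ℝ (z - z₀) v| ^ p := by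
  rcases U.eq_empty_or_nonempty with rfl | hU
  · simp [projWidth, hp]
  obtain ⟨z, hz, hzs⟩ := Finset.exists_mem_eq_sup U hU
    fun z => ‖(inner ℝ (z - z₀) v : ℝ)‖₊
  have h : projWidth U z₀ v = |inner ℝ (z - z₀) v| := by
    rw [projWidth, hzs, coe_nnnorm, Real.norm_eq_abs]
  rw [h]
  exact Finset.single_le_sum (f := fun z => |inner ℝ (z - z₀) v| ^ p)
    (fun _ _ => by positivity) hz

lemma integrable_projWidth_pow {D : ℕ} (U : Finset (EuclideanSpace ℝ (Fin D)))
    (z₀ : EuclideanSpace ℝ (Fin D)) {p : ℕ} (hp : p ≠ 0) :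
    Integrable (fun v => projWidth U z₀ v ^ p) (directionLaw D) := by
  refine Integrable.mono'
    (integrable_finsetSum U fun z _ => (integral_abs_inner_pow_le (z - z₀) p).1)
    (by fun_prop) (Filter.Eventually.of_forall fun v => ?_)
  rw [Real.norm_of_nonneg (by have := projWidth_nonneg U z₀ v; positivity)]
  exact projWidth_pow_le_sum U z₀ v hp

/-- The `6d`-th moment of the width of a projected ball, by chaining: the ball is covered by `8 ^ d`
balls of a quarter of its radius, and the maximum over these balls is bounded by the sum of the
`6d`-th powers, which costs a factor `8 ^ d = √2 ^ (6d)` only; that is outweighed by the radii, which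
are four times smaller. The recursion ends where the balls are singletons. -/
lemma integral_projWidth_pow_le {D d : ℕ} (hd : 0 < d) {S : Finset (EuclideanSpace ℝ (Fin D))}
    (hS : DoublingDimLE (S : Set (EuclideanSpace ℝ (Fin D))) d)
    {z₀ : EuclideanSpace ℝ (Fin D)} (hz₀ : z₀ ∈ S) {ρ : ℝ} (hρ : 0 < ρ) :
    ∫ v, projWidth (S.filter fun z => dist z z₀ ≤ ρ) z₀ v ^ (6 * d) ∂(directionLaw D) ≤
      (4 * ρ) ^ (6 * d) * (4 * (6 * d).factorial * (1 / Real.sqrt D) ^ (6 * d)) := by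
  classical
  set g : ℝ := 4 * (6 * d).factorial * (1 / Real.sqrt D) ^ (6 * d) with hg
  have hg0 : 0 ≤ g := by positivity
  have hp : 6 * d ≠ 0 := by omega
  obtain ⟨ρ₀, hρ₀, hsep⟩ : ∃ ρ₀ : ℝ, 0 < ρ₀ ∧ ∀ x ∈ S, ∀ y ∈ S, dist x y ≤ ρ₀ → x = y := by
    rcases S.offDiag.eq_empty_or_nonempty with h | h
    · refine ⟨1, one_pos, fun x hx y hy _ => ?_⟩
      by_contra hne
      have : (x, y) ∈ S.offDiag := Finset.mem_offDiag.2 ⟨hx, hy, hne⟩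
      simp [h] at this
    · obtain ⟨⟨a, b⟩, hab, hmin⟩ := Finset.exists_min_image _ (fun q => dist q.1 q.2) h
      have hpos : 0 < dist a b := dist_pos.2 (Finset.mem_offDiag.1 hab).2.2
      refine ⟨dist a b / 2, by linarith, fun x hx y hy hxy => ?_⟩
      by_contra hne
      have := hmin (x, y) (Finset.mem_offDiag.2 ⟨hx, hy, hne⟩)
      simp only at this
      linarith
  obtain ⟨n, hn⟩ : ∃ n : ℕ, ρ ≤ 4 ^ n * ρ₀ := by
    obtain ⟨n, hn⟩ := pow_unbounded_of_one_lt (ρ / ρ₀) (by norm_num : (1 : ℝ) < 4)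
    exact ⟨n, by rw [div_lt_iff₀ hρ₀] at hn; exact hn.le⟩
  induction n generalizing z₀ ρ with
  | zero =>
    have h0 : ∀ v, projWidth (S.filter fun z => dist z z₀ ≤ ρ) z₀ v ^ (6 * d) = 0 := by
      intro v
      have : projWidth (S.filter fun z => dist z z₀ ≤ ρ) z₀ v ≤ 0 := by
        rw [projWidth_le_iff le_rfl]
        intro z hz
        rw [Finset.mem_filter] at hz
        have : z = z₀ := hsep z hz.1 z₀ hz₀ (hz.2.trans (by simpa using hn))
        simp [this]
      rw [le_antisymm this (projWidth_nonneg _ _ _), zero_pow hp]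
    simp only [h0, integral_zero]
    positivity
  | succ n ih =>
    obtain ⟨T, hT, hTS, hcov⟩ := hS.exists_cover_mem 3 z₀ hρ
    have hcov' : ∀ z ∈ S, dist z z₀ ≤ ρ → ∃ t ∈ T, dist z t ≤ ρ / 4 := by
      intro z hz hzz
      obtain ⟨t, ht, h⟩ := hcov z hz hzz
      exact ⟨t, ht, h.trans (by linarith)⟩
    let W : EuclideanSpace ℝ (Fin D) → EuclideanSpace ℝ (Fin D) → ℝ :=
      fun t v => projWidth (S.filter fun z => dist z t ≤ ρ / 4) t v
    have hWi : ∀ t, Integrable (fun v => W t v ^ (6 * d)) (directionLaw D) :=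
      fun t => integrable_projWidth_pow _ _ hp
    have hLi : ∀ t, Integrable (fun v => |inner ℝ (t - z₀) v| ^ (6 * d)) (directionLaw D) :=
      fun t => (integral_abs_inner_pow_le _ _).1
    have hpt : ∀ v, projWidth (S.filter fun z => dist z z₀ ≤ ρ) z₀ v ^ (6 * d) ≤
        ∑ t ∈ T, 2 ^ (6 * d - 1) * (|inner ℝ (t - z₀) v| ^ (6 * d) + W t v ^ (6 * d)) := by
      intro v
      have hU : (S.filter fun z => dist z z₀ ≤ ρ).Nonempty :=
        ⟨z₀, Finset.mem_filter.2 ⟨hz₀, by simpa using hρ.le⟩⟩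
      obtain ⟨z, hz, hzs⟩ := Finset.exists_mem_eq_sup _ hU
        fun z => ‖(inner ℝ (z - z₀) v : ℝ)‖₊
      have h : projWidth (S.filter fun z => dist z z₀ ≤ ρ) z₀ v = |inner ℝ (z - z₀) v| := by
        rw [projWidth, hzs, coe_nnnorm, Real.norm_eq_abs]
      rw [Finset.mem_filter] at hz
      obtain ⟨t, ht, hzt⟩ := hcov' z hz.1 hz.2
      have h1 : |inner ℝ (z - z₀) v| ≤ |inner ℝ (t - z₀) v| + W t v := by
        have e : inner ℝ (z - z₀) v = inner ℝ (t - z₀) v + inner ℝ (z - t) v := by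
          rw [← inner_add_left]; congr 1; abel
        rw [e]
        refine (abs_add_le _ _).trans ?_
        gcongr
        exact abs_inner_le_projWidth (Finset.mem_filter.2 ⟨hz.1, hzt⟩)
      have hW0 : 0 ≤ W t v := projWidth_nonneg _ _ _
      rw [h]
      calc |inner ℝ (z - z₀) v| ^ (6 * d) ≤ (|inner ℝ (t - z₀) v| + W t v) ^ (6 * d) := by gcongr
        _ ≤ 2 ^ (6 * d - 1) * (|inner ℝ (t - z₀) v| ^ (6 * d) + W t v ^ (6 * d)) :=
            add_pow_le (abs_nonneg _) hW0 _
        _ ≤ _ := by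
            refine Finset.single_le_sum (f := fun t =>
              2 ^ (6 * d - 1) * (|inner ℝ (t - z₀) v| ^ (6 * d) + W t v ^ (6 * d)))
              (fun t _ => ?_) ht
            have : 0 ≤ W t v := projWidth_nonneg _ _ _
            positivity
    have hsumi : ∀ t ∈ T, Integrable (fun v =>
        2 ^ (6 * d - 1) * (|inner ℝ (t - z₀) v| ^ (6 * d) + W t v ^ (6 * d))) (directionLaw D) :=
      fun t _ => ((hLi t).add (hWi t)).const_mul _
    calc ∫ v, projWidth (S.filter fun z => dist z z₀ ≤ ρ) z₀ v ^ (6 * d) ∂(directionLaw D)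
        ≤ ∫ v, ∑ t ∈ T, 2 ^ (6 * d - 1) * (|inner ℝ (t - z₀) v| ^ (6 * d) + W t v ^ (6 * d))
            ∂(directionLaw D) :=
          integral_mono (integrable_projWidth_pow _ _ hp) (integrable_finsetSum _ hsumi) hpt
      _ = ∑ t ∈ T, 2 ^ (6 * d - 1) * (∫ v, |inner ℝ (t - z₀) v| ^ (6 * d) ∂(directionLaw D) +
            ∫ v, W t v ^ (6 * d) ∂(directionLaw D)) := by
          rw [integral_finsetSum _ hsumi]
          refine Finset.sum_congr rfl fun t _ => ?_
          rw [integral_const_mul, integral_add (hLi t) (hWi t)]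
      _ ≤ ∑ t ∈ T, 2 ^ (6 * d - 1) * (ρ ^ (6 * d) * g + ρ ^ (6 * d) * g) := by
          refine Finset.sum_le_sum fun t ht => ?_
          have hts := hTS t ht
          have h1 : ∫ v, |inner ℝ (t - z₀) v| ^ (6 * d) ∂(directionLaw D) ≤ ρ ^ (6 * d) * g := by
            refine (integral_abs_inner_pow_le _ _).2.trans ?_
            have : ‖t - z₀‖ ≤ ρ := by rw [← dist_eq_norm]; exact hts.2
            rw [hg, div_eq_mul_one_div, mul_pow]
            calc _ = ‖t - z₀‖ ^ (6 * d) *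
                  (4 * (6 * d).factorial * (1 / Real.sqrt D) ^ (6 * d)) := by ring
              _ ≤ _ := by gcongr
          have h2 : ∫ v, W t v ^ (6 * d) ∂(directionLaw D) ≤ ρ ^ (6 * d) * g := by
            have := ih (z₀ := t) (ρ := ρ / 4) hts.1 (by linarith)
              (by rw [pow_succ] at hn; linarith)
            rwa [mul_div_cancel₀ _ (by norm_num : (4 : ℝ) ≠ 0)] at this
          gcongr
      _ = T.card * 2 ^ (6 * d) * (ρ ^ (6 * d) * g) := by
          rw [Finset.sum_const, nsmul_eq_mul, show 6 * d = 6 * d - 1 + 1 by omega]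
          simp only [Nat.add_sub_cancel]
          ring
      _ ≤ 2 ^ (d * 3) * 2 ^ (6 * d) * (ρ ^ (6 * d) * g) := by
          gcongr
          exact_mod_cast hT
      _ ≤ 4 ^ (6 * d) * (ρ ^ (6 * d) * g) := by
          gcongr
          rw [show (4 : ℝ) = 2 ^ 2 by norm_num, ← pow_mul, ← pow_add]
          exact pow_le_pow_right₀ (by norm_num) (by omega)
      _ = (4 * ρ) ^ (6 * d) * g := by rw [mul_pow]; ring

lemma integrable_projWidth {D : ℕ} (U : Finset (EuclideanSpace ℝ (Fin D)))
    (z₀ : EuclideanSpace ℝ (Fin D)) : Integrable (projWidth U z₀) (directionLaw D) := by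
  simpa using integrable_projWidth_pow U z₀ one_ne_zero

/-- The expected width of a projected ball of radius `ρ` is `O(d ρ / √D)`. The dependence on `d` is
not optimal, but only its logarithm matters below. -/
lemma integral_projWidth_le {D d : ℕ} (hd : 0 < d) {S U : Finset (EuclideanSpace ℝ (Fin D))}
    (hS : DoublingDimLE (S : Set (EuclideanSpace ℝ (Fin D))) d)
    {z₀ : EuclideanSpace ℝ (Fin D)} (hz₀ : z₀ ∈ S) {ρ : ℝ} (hρ : 0 < ρ)
    (hU : ∀ z ∈ U, z ∈ S ∧ dist z z₀ ≤ ρ) (hD : 0 < D) :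
    ∫ v, projWidth U z₀ v ∂(directionLaw D) ≤ 192 * d * ρ / Real.sqrt D := by
  have hD' : 0 < Real.sqrt D := Real.sqrt_pos.2 (by exact_mod_cast hD)
  have hd' : (1 : ℝ) ≤ d := by exact_mod_cast hd
  set s : ℝ := 96 * d * ρ / Real.sqrt D with hs
  have hs0 : 0 < s := by positivity
  set V := S.filter fun z => dist z z₀ ≤ ρ with hV
  have hp : 6 * d ≠ 0 := by omega
  have hmom : ∫ v, projWidth V z₀ v ^ (6 * d) ∂(directionLaw D) ≤ s ^ (6 * d) := by
    refine (integral_projWidth_pow_le hd hS hz₀ hρ).trans ?_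
    have h1 : ((6 * d).factorial : ℝ) ≤ (6 * d : ℝ) ^ (6 * d) := by
      exact_mod_cast Nat.factorial_le_pow (6 * d)
    have h2 : (4 : ℝ) ≤ 4 ^ (6 * d) := le_self_pow₀ (by norm_num) hp
    calc (4 * ρ) ^ (6 * d) * (4 * (6 * d).factorial * (1 / Real.sqrt D) ^ (6 * d))
        ≤ (4 * ρ) ^ (6 * d) * (4 ^ (6 * d) * (6 * d : ℝ) ^ (6 * d) *
            (1 / Real.sqrt D) ^ (6 * d)) := by gcongr
      _ = s ^ (6 * d) := by
          rw [← mul_pow, ← mul_pow, ← mul_pow, hs]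
          congr 1
          ring
  have hpt : ∀ v, projWidth U z₀ v ≤ s + projWidth V z₀ v ^ (6 * d) / s ^ (6 * d - 1) := by
    intro v
    have h0 := projWidth_nonneg V z₀ v
    have hUV : projWidth U z₀ v ≤ projWidth V z₀ v := by
      rw [projWidth_le_iff h0]
      exact fun z hz => abs_inner_le_projWidth (Finset.mem_filter.2 (hU z hz))
    refine hUV.trans ?_
    rcases le_total (projWidth V z₀ v) s with h | h
    · have : 0 ≤ projWidth V z₀ v ^ (6 * d) / s ^ (6 * d - 1) := by positivity
      linarith
    · have h3 : s ^ (6 * d - 1) * projWidth V z₀ v ≤ projWidth V z₀ v ^ (6 * d) := by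
        calc s ^ (6 * d - 1) * projWidth V z₀ v
            ≤ projWidth V z₀ v ^ (6 * d - 1) * projWidth V z₀ v := by gcongr
          _ = projWidth V z₀ v ^ (6 * d) := by rw [← pow_succ]; congr 1; omega
      have h4 : projWidth V z₀ v ≤ projWidth V z₀ v ^ (6 * d) / s ^ (6 * d - 1) := by
        rw [le_div_iff₀ (by positivity)]; linarith
      linarith
  have hVi := integrable_projWidth_pow V z₀ hp
  calc ∫ v, projWidth U z₀ v ∂(directionLaw D)
      ≤ ∫ v, (s + projWidth V z₀ v ^ (6 * d) / s ^ (6 * d - 1)) ∂(directionLaw D) :=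
        integral_mono (integrable_projWidth U z₀)
          ((integrable_const _).add (hVi.div_const _)) hpt
    _ = s + (∫ v, projWidth V z₀ v ^ (6 * d) ∂(directionLaw D)) / s ^ (6 * d - 1) := by
        rw [integral_add (integrable_const _) (hVi.div_const _), integral_const, probReal_univ,
          one_smul, integral_div]
    _ ≤ s + s ^ (6 * d) / s ^ (6 * d - 1) := by gcongr
    _ = s + s := by
        congr 1
        rw [div_eq_iff (by positivity), ← pow_succ']
        congr 1; omega
    _ = 192 * d * ρ / Real.sqrt D := by rw [hs]; ring

/-! ### The radius of a cell and its estimate -/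

lemma radius_le {D : ℕ} {C : Finset (EuclideanSpace ℝ (Fin D))} {y : EuclideanSpace ℝ (Fin D)}
    {ρ : ℝ} (hρ : 0 ≤ ρ) (h : ∀ z ∈ C, dist z y ≤ ρ) : radius C ≤ ρ :=
  csInf_le ⟨0, fun _ h => h.1⟩ ⟨hρ, y, h⟩

lemma exists_radius_bound {D : ℕ} (C : Finset (EuclideanSpace ℝ (Fin D))) :
    {ρ : ℝ | 0 ≤ ρ ∧ ∃ y : EuclideanSpace ℝ (Fin D), ∀ z ∈ C, dist z y ≤ ρ}.Nonempty := by
  refine ⟨∑ z ∈ C, dist z 0, Finset.sum_nonneg fun _ _ => dist_nonneg, 0, fun z hz => ?_⟩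
  exact Finset.single_le_sum (f := fun z => dist z 0) (fun _ _ => dist_nonneg) hz

lemma radius_nonneg {D : ℕ} (C : Finset (EuclideanSpace ℝ (Fin D))) : 0 ≤ radius C :=
  le_csInf (exists_radius_bound C) fun _ h => h.1

lemma exists_center_of_radius_lt {D : ℕ} {C : Finset (EuclideanSpace ℝ (Fin D))} {ρ : ℝ}
    (h : radius C < ρ) : ∃ y : EuclideanSpace ℝ (Fin D), ∀ z ∈ C, dist z y ≤ ρ := by
  obtain ⟨ρ', ⟨_, y, hy⟩, hlt⟩ := exists_lt_of_csInf_lt (exists_radius_bound C) h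
  exact ⟨y, fun z hz => (hy z hz).trans hlt.le⟩

lemma radius_mono {D : ℕ} {C C' : Finset (EuclideanSpace ℝ (Fin D))} (h : C' ⊆ C) :
    radius C' ≤ radius C :=
  csInf_le_csInf ⟨0, fun _ h => h.1⟩ (exists_radius_bound C)
    fun _ ⟨h0, y, hy⟩ => ⟨h0, y, fun z hz => hy z (h hz)⟩

lemma nonempty_of_radius_pos {D : ℕ} {C : Finset (EuclideanSpace ℝ (Fin D))}
    (h : 0 < radius C) : C.Nonempty := by
  by_contra hC
  rw [Finset.not_nonempty_iff_eq_empty] at hC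
  subst hC
  exact absurd (radius_le (y := 0) le_rfl (by simp)) h.not_ge

lemma dim_pos_of_radius_pos {D : ℕ} {C : Finset (EuclideanSpace ℝ (Fin D))}
    (h : 0 < radius C) : 0 < D := by
  by_contra hD
  obtain rfl : D = 0 := by omega
  exact absurd (radius_le (y := 0) le_rfl fun z _ => by simp [Subsingleton.elim z 0]) h.not_ge

lemma exists_far_of_lt_radius {D : ℕ} {C : Finset (EuclideanSpace ℝ (Fin D))} {ρ : ℝ}
    (hρ : 0 ≤ ρ) (h : ρ < radius C) (p : EuclideanSpace ℝ (Fin D)) : ∃ y ∈ C, ρ < dist y p := by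
  by_contra! hcon
  exact absurd (radius_le hρ hcon) h.not_ge

lemma dist_le_radiusEstimate {D : ℕ} {p y : EuclideanSpace ℝ (Fin D)}
    {C : Finset (EuclideanSpace ℝ (Fin D))} (hy : y ∈ C) : dist y p ≤ radiusEstimate p C := by
  rw [radiusEstimate, dist_comm, ← coe_nndist, NNReal.coe_le_coe]
  exact Finset.le_sup (f := fun y => nndist p y) hy

lemma radius_le_radiusEstimate {D : ℕ} (p : EuclideanSpace ℝ (Fin D))
    (C : Finset (EuclideanSpace ℝ (Fin D))) : radius C ≤ radiusEstimate p C :=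
  radius_le (NNReal.coe_nonneg _) fun _ hz => dist_le_radiusEstimate hz

lemma radiusEstimate_le {D : ℕ} {p : EuclideanSpace ℝ (Fin D)}
    {C : Finset (EuclideanSpace ℝ (Fin D))} (hp : p ∈ C) :
    radiusEstimate p C ≤ 2 * radius C := by
  refine le_of_forall_pos_le_add fun ε hε => ?_
  obtain ⟨c, hc⟩ := exists_center_of_radius_lt (C := C) (ρ := radius C + ε / 2) (by linarith)
  have h0 : (0 : ℝ) ≤ 2 * radius C + ε := by linarith [radius_nonneg C]
  rw [radiusEstimate]
  lift 2 * radius C + ε to ℝ≥0 using h0 with a ha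
  rw [NNReal.coe_le_coe, Finset.sup_le_iff]
  intro y hy
  rw [← NNReal.coe_le_coe, coe_nndist, ha]
  have := dist_triangle_right p y c
  linarith [hc p hp, hc y hy]

/-! ### The median -/

/-- If fewer than half of the projected points are further than `a` from `m`, then the median is
within `a` of `m`. -/
lemma abs_median_sub_le {D : ℕ} {C : Finset (EuclideanSpace ℝ (Fin D))}
    {v : EuclideanSpace ℝ (Fin D)} {m a : ℝ}
    (h : 2 * (C.filter fun z => a < |inner ℝ z v - m|).card < C.card) :
    |median C v - m| ≤ a := by
  classical
  have hle : ∀ t, t < m - a →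
      ¬ C.card ≤ 2 * (C.filter fun z => inner ℝ z v ≤ t).card := by
    intro t ht hc
    have : (C.filter fun z => inner ℝ z v ≤ t).card ≤
        (C.filter fun z => a < |inner ℝ z v - m|).card := by
      refine Finset.card_le_card fun z hz => ?_
      rw [Finset.mem_filter] at hz ⊢
      refine ⟨hz.1, ?_⟩
      rw [lt_abs]; right; linarith [hz.2]
    omega
  have hge : ∀ t, m + a < t →
      ¬ C.card ≤ 2 * (C.filter fun z => t ≤ inner ℝ z v).card := by
    intro t ht hc
    have : (C.filter fun z => t ≤ inner ℝ z v).card ≤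
        (C.filter fun z => a < |inner ℝ z v - m|).card := by
      refine Finset.card_le_card fun z hz => ?_
      rw [Finset.mem_filter] at hz ⊢
      refine ⟨hz.1, ?_⟩
      rw [lt_abs]; left; linarith [hz.2]
    omega
  have hcompl := Finset.card_filter_add_card_filter_not (s := C)
    (fun z => a < |inner ℝ z v - m|)
  have hup : C.card ≤ 2 * (C.filter fun z => inner ℝ z v ≤ m + a).card := by
    have : (C.filter fun z => ¬ a < |inner ℝ z v - m|).card ≤
        (C.filter fun z => inner ℝ z v ≤ m + a).card := by
      refine Finset.card_le_card fun z hz => ?_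
      rw [Finset.mem_filter, not_lt, abs_le] at hz
      rw [Finset.mem_filter]
      exact ⟨hz.1, by linarith [hz.2.2]⟩
    omega
  have hlow : C.card ≤ 2 * (C.filter fun z => m - a ≤ inner ℝ z v).card := by
    have : (C.filter fun z => ¬ a < |inner ℝ z v - m|).card ≤
        (C.filter fun z => m - a ≤ inner ℝ z v).card := by
      refine Finset.card_le_card fun z hz => ?_
      rw [Finset.mem_filter, not_lt, abs_le] at hz
      rw [Finset.mem_filter]
      exact ⟨hz.1, by linarith [hz.2.1]⟩
    omega
  have b1 : m - a ≤ sInf {t : ℝ | C.card ≤ 2 * (C.filter fun z => inner ℝ z v ≤ t).card} :=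
    le_csInf ⟨_, hup⟩ fun t ht => not_lt.1 fun hlt => hle t hlt ht
  have b2 : sInf {t : ℝ | C.card ≤ 2 * (C.filter fun z => inner ℝ z v ≤ t).card} ≤ m + a :=
    csInf_le ⟨m - a, fun t ht => not_lt.1 fun hlt => hle t hlt ht⟩ hup
  have b3 : sSup {t : ℝ | C.card ≤ 2 * (C.filter fun z => t ≤ inner ℝ z v).card} ≤ m + a :=
    csSup_le ⟨_, hlow⟩ fun t ht => not_lt.1 fun hlt => hge t hlt ht
  have b4 : m - a ≤ sSup {t : ℝ | C.card ≤ 2 * (C.filter fun z => t ≤ inner ℝ z v).card} :=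
    le_csSup ⟨m + a, fun t ht => not_lt.1 fun hlt => hge t hlt ht⟩ hlow
  rw [median, abs_le]
  constructor <;> linarith

/-- The lower median is at most `t` if and only if half of the points are, so its sublevel sets are
finite unions of intersections of half-spaces. -/
lemma measurable_lowerMedian {D : ℕ} (C : Finset (EuclideanSpace ℝ (Fin D))) :
    Measurable fun v : EuclideanSpace ℝ (Fin D) =>
      sInf {t : ℝ | C.card ≤ 2 * (C.filter fun z => inner ℝ z v ≤ t).card} := by
  classical
  rcases C.eq_empty_or_nonempty with rfl | hC
  · simp
  have hcard : 0 < C.card := hC.card_pos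
  refine measurable_of_Iic fun t => ?_
  have hmono : ∀ (v : EuclideanSpace ℝ (Fin D)) {s t : ℝ}, s ≤ t →
      (C.filter fun z => inner ℝ z v ≤ s).card ≤ (C.filter fun z => inner ℝ z v ≤ t).card :=
    fun v s t hst => Finset.card_le_card fun z hz => by
      rw [Finset.mem_filter] at hz ⊢
      exact ⟨hz.1, hz.2.trans hst⟩
  have hset : (fun v : EuclideanSpace ℝ (Fin D) =>
      sInf {t : ℝ | C.card ≤ 2 * (C.filter fun z => inner ℝ z v ≤ t).card}) ⁻¹' Set.Iic t =
      {v | C.card ≤ 2 * (C.filter fun z => inner ℝ z v ≤ t).card} := by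
    ext v
    simp only [Set.mem_preimage, Set.mem_Iic, Set.mem_ofPred_eq]
    have hbdd : BddBelow {t : ℝ | C.card ≤ 2 * (C.filter fun z => inner ℝ z v ≤ t).card} := by
      obtain ⟨z₀, hz₀, hmin⟩ := C.exists_min_image (fun z => inner ℝ z v) hC
      refine ⟨inner ℝ z₀ v, fun s hs => ?_⟩
      by_contra! hlt
      have : (C.filter fun z => inner ℝ z v ≤ s) = ∅ :=
        Finset.filter_eq_empty_iff.2 fun z hz hzs => by linarith [hmin z hz]
      simp only [Set.mem_ofPred_eq, this, Finset.card_empty] at hs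
      omega
    constructor
    · intro h
      by_contra hcon
      -- The finitely many projections exceeding `t` are at least some `s > t`.
      obtain ⟨s, hts, hs⟩ : ∃ s, t < s ∧ ∀ z ∈ C, inner ℝ z v < s → inner ℝ z v ≤ t := by
        rcases (C.filter fun z => t < inner ℝ z v).eq_empty_or_nonempty with he | hne
        · refine ⟨t + 1, by linarith, fun z hz _ => ?_⟩
          by_contra! hlt
          exact (Finset.filter_eq_empty_iff.1 he) hz hlt
        · obtain ⟨z₁, hz₁, hmin⟩ := Finset.exists_min_image _ (fun z => (inner ℝ z v : ℝ)) hne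
          refine ⟨inner ℝ z₁ v, (Finset.mem_filter.1 hz₁).2, fun z hz hlt => ?_⟩
          by_contra! hlt'
          exact absurd (hmin z (Finset.mem_filter.2 ⟨hz, hlt'⟩)) hlt.not_ge
      have hne : {t : ℝ | C.card ≤ 2 * (C.filter fun z => inner ℝ z v ≤ t).card}.Nonempty := by
        obtain ⟨z₀, hz₀, hmax⟩ := C.exists_max_image (fun z => (inner ℝ z v : ℝ)) hC
        refine ⟨inner ℝ z₀ v, ?_⟩
        rw [Set.mem_ofPred_eq, Finset.filter_true_of_mem hmax]
        omega
      obtain ⟨s', hs', hlt⟩ := exists_lt_of_csInf_lt hne (h.trans_lt hts)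
      have : (C.filter fun z => inner ℝ z v ≤ s').card ≤
          (C.filter fun z => inner ℝ z v ≤ t).card :=
        Finset.card_le_card fun z hz => by
          rw [Finset.mem_filter] at hz ⊢
          exact ⟨hz.1, hs z hz.1 (hz.2.trans_lt hlt)⟩
      simp only [Set.mem_ofPred_eq] at hs'
      omega
    · exact fun h => csInf_le hbdd h
  rw [hset]
  refine measurableSet_le measurable_const ?_
  simp_rw [Finset.card_filter]
  refine (Finset.measurable_sum _ fun z _ => ?_).const_mul 2
  exact Measurable.ite (measurableSet_le (by fun_prop) measurable_const)
    measurable_const measurable_const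

@[fun_prop]
lemma measurable_median {D : ℕ} (C : Finset (EuclideanSpace ℝ (Fin D))) :
    Measurable (median C) := by
  have hup : ∀ v : EuclideanSpace ℝ (Fin D),
      sSup {t : ℝ | C.card ≤ 2 * (C.filter fun z => t ≤ inner ℝ z v).card} =
      -sInf {t : ℝ | C.card ≤ 2 * (C.filter fun z => inner ℝ z (-v) ≤ t).card} := by
    intro v
    rw [Real.sInf_def, neg_neg]
    congr 1
    ext t
    simp [inner_neg_right]
  unfold median
  simp_rw [hup]
  exact ((measurable_lowerMedian C).add
    ((measurable_lowerMedian C).comp measurable_neg).neg).div_const 2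

@[fun_prop]
lemma measurable_splitPoint {D : ℕ} (C : Finset (EuclideanSpace ℝ (Fin D)))
    (p : EuclideanSpace ℝ (Fin D)) :
    Measurable fun y : EuclideanSpace ℝ (Fin D) × ℝ => splitPoint C p y.1 y.2 := by
  unfold splitPoint
  exact ((measurable_median C).comp measurable_fst).add (measurable_snd.mul_const _)

/-- The median of the projected cell is close to the projected pivot: on average at most `1 / 9` of
the points deviate by `3 Δ̃ / √D`, and Markov's inequality applies. -/
lemma directionLaw_median_le {D : ℕ} {C : Finset (EuclideanSpace ℝ (Fin D))}
    {p : EuclideanSpace ℝ (Fin D)} (hC : C.Nonempty) :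
    (directionLaw D).real {v | 3 * (radiusEstimate p C / Real.sqrt D) <
      |median C v - inner ℝ p v|} ≤ 2 / 9 := by
  classical
  set a := 3 * (radiusEstimate p C / Real.sqrt D) with ha
  have hcard : (0 : ℝ) < C.card := by exact_mod_cast hC.card_pos
  let A : EuclideanSpace ℝ (Fin D) → Set (EuclideanSpace ℝ (Fin D)) :=
    fun z => {v | a < |inner ℝ z v - inner ℝ p v|}
  have hA : ∀ z, MeasurableSet (A z) := fun z => measurableSet_lt (by fun_prop) (by fun_prop)
  let f : EuclideanSpace ℝ (Fin D) → ℝ := fun v => ∑ z ∈ C, (A z).indicator 1 v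
  have hfi : ∀ z ∈ C, Integrable ((A z).indicator (1 : EuclideanSpace ℝ (Fin D) → ℝ))
      (directionLaw D) := fun z _ => (integrable_const 1).indicator (hA z)
  have hf : ∀ v, f v = (C.filter fun z => a < |inner ℝ z v - inner ℝ p v|).card := by
    intro v
    simp only [f, A, Finset.card_filter, Set.indicator_apply, Set.mem_ofPred_eq, Pi.one_apply]
    push_cast
    rfl
  have hint : ∫ v, f v ∂(directionLaw D) ≤ C.card * (1 / 9) := by
    rw [integral_finsetSum _ hfi, ← nsmul_eq_mul]
    refine Finset.sum_le_card_nsmul _ _ _ fun z hz => ?_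
    rw [integral_indicator_one (hA z)]
    refine le_trans (measureReal_mono ?_)
      ((directionLaw_abs_inner_gt_le (z - p) (t := 3) (by norm_num)).trans (by norm_num))
    intro v hv
    simp only [A, Set.mem_ofPred_eq] at hv ⊢
    rw [inner_sub_left]
    refine lt_of_le_of_lt ?_ hv
    rw [ha, ← dist_eq_norm]
    have := dist_le_radiusEstimate (p := p) hz
    gcongr
  have hmarkov := mul_meas_ge_le_integral_of_nonneg (μ := directionLaw D) (f := f)
    (Filter.Eventually.of_forall fun v => by simp only [hf]; positivity)
    (integrable_finsetSum _ hfi) (C.card / 2)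
  have hsub : (directionLaw D).real {v | a < |median C v - inner ℝ p v|} ≤
      (directionLaw D).real {v | (C.card : ℝ) / 2 ≤ f v} := by
    refine measureReal_mono fun v hv => ?_
    simp only [Set.mem_ofPred_eq] at hv ⊢
    by_contra! hlt
    rw [hf] at hlt
    refine absurd (abs_median_sub_le (C := C) (v := v) (m := inner ℝ p v) (a := a) ?_) hv.not_ge
    have : 2 * ((C.filter fun z => a < |inner ℝ z v - inner ℝ p v|).card : ℝ) < C.card := by
      linarith
    exact_mod_cast this
  refine hsub.trans ?_
  have h := hmarkov.trans hint
  have h9 : (C.card : ℝ) * ((directionLaw D).real {v | (C.card : ℝ) / 2 ≤ f v}) ≤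
      C.card * (2 / 9) := by linarith
  exact le_of_mul_le_mul_left h9 hcard

/-! ### The random split of a cell -/

/-- The law of the random choices at one node. -/
noncomputable abbrev nodeLaw (D : ℕ) : Measure (EuclideanSpace ℝ (Fin D) × ℝ) :=
  (directionLaw D).prod offsetLaw

lemma offsetLaw_apply {A : Set ℝ} :
    offsetLaw A = (2 : ℝ≥0∞)⁻¹ * volume (Set.Icc (-1) 1 ∩ A) := by
  rw [offsetLaw, cond_apply measurableSet_Icc, Real.volume_Icc]
  norm_num

lemma offsetLaw_abs_sub_le (f : ℝ) (w : ℝ) {s : ℝ} (hs : 0 < s) :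
    offsetLaw {u | |u * s - f| ≤ w} ≤ ENNReal.ofReal (w / s) := by
  have hsub : {u | |u * s - f| ≤ w} ⊆ Set.Icc ((f - w) / s) ((f + w) / s) := by
    intro u hu
    have hu' : |u * s - f| ≤ w := hu
    rw [abs_le] at hu'
    rw [Set.mem_Icc, div_le_iff₀ hs, le_div_iff₀ hs]
    constructor <;> linarith
  rw [offsetLaw_apply]
  calc (2 : ℝ≥0∞)⁻¹ * volume (Set.Icc (-1) 1 ∩ {u | |u * s - f| ≤ w})
      ≤ (2 : ℝ≥0∞)⁻¹ * volume (Set.Icc ((f - w) / s) ((f + w) / s)) := by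
        gcongr
        exact Set.inter_subset_right.trans hsub
    _ = ENNReal.ofReal (w / s) := by
        rw [Real.volume_Icc, show (f + w) / s - (f - w) / s = 2 * (w / s) by ring,
          ENNReal.ofReal_mul (by norm_num), ENNReal.ofReal_ofNat, ← mul_assoc,
          ENNReal.inv_mul_cancel (by norm_num) (by norm_num), one_mul]

lemma le_offsetLaw_Ioo {m s lo hi : ℝ} (hs : 0 < s) (h1 : m - s ≤ lo) (h2 : hi ≤ m + s) :
    ENNReal.ofReal ((hi - lo) / (2 * s)) ≤ offsetLaw {u | lo < m + u * s ∧ m + u * s < hi} := by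
  have hsub : Set.Ioo ((lo - m) / s) ((hi - m) / s) ⊆
      Set.Icc (-1) 1 ∩ {u | lo < m + u * s ∧ m + u * s < hi} := by
    intro u hu
    rw [Set.mem_Ioo, div_lt_iff₀ hs, lt_div_iff₀ hs] at hu
    refine ⟨⟨?_, ?_⟩, ?_, ?_⟩
    · by_contra! h
      nlinarith [hu.1, mul_lt_mul_of_pos_right h hs]
    · by_contra! h
      nlinarith [hu.2, mul_lt_mul_of_pos_right h hs]
    · linarith [hu.1]
    · linarith [hu.2]
  rw [offsetLaw_apply]
  calc ENNReal.ofReal ((hi - lo) / (2 * s))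
      = (2 : ℝ≥0∞)⁻¹ * volume (Set.Ioo ((lo - m) / s) ((hi - m) / s)) := by
        rw [Real.volume_Ioo, show (hi - lo) / (2 * s) =
            2⁻¹ * ((hi - m) / s - (lo - m) / s) by field_simp; ring,
          ENNReal.ofReal_mul (by norm_num), ENNReal.ofReal_inv_of_pos (by norm_num),
          ENNReal.ofReal_ofNat]
    _ ≤ _ := by gcongr

/-- Cells are finite subsets of a fixed set, so the discrete `σ`-algebra is the natural one. -/
instance {D : ℕ} : MeasurableSpace (Finset (EuclideanSpace ℝ (Fin D))) := ⊤

instance {D : ℕ} : DiscreteMeasurableSpace (Finset (EuclideanSpace ℝ (Fin D))) :=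
  ⟨fun _ => trivial⟩

lemma measurable_child {D : ℕ} (C : Finset (EuclideanSpace ℝ (Fin D)))
    (p : EuclideanSpace ℝ (Fin D)) (b : Bool) :
    Measurable fun y : EuclideanSpace ℝ (Fin D) × ℝ =>
      child C y.1 (splitPoint C p y.1 y.2) b := by
  classical
  let side : EuclideanSpace ℝ (Fin D) × ℝ → (C → Prop) :=
    fun y z => inner ℝ (z : EuclideanSpace ℝ (Fin D)) y.1 < splitPoint C p y.1 y.2
  have hside : Measurable side := by
    refine measurable_pi_iff.2 fun z => ?_
    refine measurableSet_setOfPred.1 ?_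
    exact measurableSet_lt (by fun_prop) (by fun_prop)
  let g : (C → Prop) → Finset (EuclideanSpace ℝ (Fin D)) := fun q =>
    if b then (C.attach.filter fun z => q z).map ⟨_, Subtype.val_injective⟩
    else (C.attach.filter fun z => ¬ q z).map ⟨_, Subtype.val_injective⟩
  have hg : (fun y : EuclideanSpace ℝ (Fin D) × ℝ => child C y.1 (splitPoint C p y.1 y.2) b) =
      g ∘ side := by
    funext y
    ext z
    cases b <;> simp [g, side, child, and_comm]
  rw [hg]
  exact (measurable_of_finite g).comp hside

lemma child_subset {D : ℕ} (C : Finset (EuclideanSpace ℝ (Fin D)))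
    (v : EuclideanSpace ℝ (Fin D)) (t : ℝ) (b : Bool) : child C v t b ⊆ C := by
  cases b <;> exact Finset.filter_subset _ _

/-- Any function of the two children is measurable, since the right child is determined by the left
one. -/
lemma measurable_children {D : ℕ} {α : Type*} [MeasurableSpace α]
    (C : Finset (EuclideanSpace ℝ (Fin D))) (p : EuclideanSpace ℝ (Fin D))
    (g : Finset (EuclideanSpace ℝ (Fin D)) → Finset (EuclideanSpace ℝ (Fin D)) → α) :
    Measurable fun y : EuclideanSpace ℝ (Fin D) × ℝ =>
      g (child C y.1 (splitPoint C p y.1 y.2) true)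
        (child C y.1 (splitPoint C p y.1 y.2) false) := by
  classical
  have h : ∀ y : EuclideanSpace ℝ (Fin D) × ℝ, child C y.1 (splitPoint C p y.1 y.2) false =
      C \ child C y.1 (splitPoint C p y.1 y.2) true := by
    intro y
    simp only [child]
    rw [Finset.filter_not]
  simp_rw [h]
  exact (Measurable.of_discrete (f := fun L => g L (C \ L))).comp (measurable_child C p true)

lemma integrable_children {D : ℕ} (C : Finset (EuclideanSpace ℝ (Fin D)))
    (p : EuclideanSpace ℝ (Fin D))
    (g : Finset (EuclideanSpace ℝ (Fin D)) → Finset (EuclideanSpace ℝ (Fin D)) → ℝ) :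
    Integrable (fun y : EuclideanSpace ℝ (Fin D) × ℝ =>
      g (child C y.1 (splitPoint C p y.1 y.2) true)
        (child C y.1 (splitPoint C p y.1 y.2) false)) (nodeLaw D) := by
  refine Integrable.of_bound (measurable_children C p g).aestronglyMeasurable
    (∑ q ∈ C.powerset ×ˢ C.powerset, |g q.1 q.2|) (Filter.Eventually.of_forall fun y => ?_)
  refine Finset.single_le_sum (f := fun q : Finset (EuclideanSpace ℝ (Fin D)) ×
    Finset (EuclideanSpace ℝ (Fin D)) => |g q.1 q.2|) (fun _ _ => abs_nonneg _)
    (a := (child C y.1 (splitPoint C p y.1 y.2) true,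
      child C y.1 (splitPoint C p y.1 y.2) false)) ?_
  exact Finset.mem_product.2 ⟨Finset.mem_powerset.2 (child_subset _ _ _ _),
    Finset.mem_powerset.2 (child_subset _ _ _ _)⟩

/-- `C` has a point in `U`. -/
def Meets {D : ℕ} (C : Finset (EuclideanSpace ℝ (Fin D)))
    (U : Set (EuclideanSpace ℝ (Fin D))) : Prop := ∃ z ∈ C, z ∈ U

lemma Meets.mono {D : ℕ} {C C' : Finset (EuclideanSpace ℝ (Fin D))}
    {U : Set (EuclideanSpace ℝ (Fin D))} (h : Meets C' U) (hC : C' ⊆ C) : Meets C U :=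
  let ⟨z, hz, hU⟩ := h; ⟨z, hC hz, hU⟩

/-- If both children have points in `U`, then the split point lies within the projection of
`C ∩ U`. -/
lemma abs_splitPoint_sub_le {D : ℕ} {C V : Finset (EuclideanSpace ℝ (Fin D))}
    {U : Set (EuclideanSpace ℝ (Fin D))} {p z₀ v : EuclideanSpace ℝ (Fin D)} {u : ℝ}
    (hV : ∀ z ∈ C, z ∈ U → z ∈ V)
    (hl : Meets (child C v (splitPoint C p v u) true) U)
    (hr : Meets (child C v (splitPoint C p v u) false) U) :
    |u * (6 * radiusEstimate p C / Real.sqrt D) - (inner ℝ z₀ v - median C v)| ≤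
      projWidth V z₀ v := by
  obtain ⟨z, hz, hzU⟩ := hl
  obtain ⟨z', hz', hzU'⟩ := hr
  simp only [child, Finset.mem_filter, not_lt] at hz hz'
  have h1 := abs_inner_le_projWidth (z₀ := z₀) (v := v) (hV z hz.1 hzU)
  have h2 := abs_inner_le_projWidth (z₀ := z₀) (v := v) (hV z' hz'.1 hzU')
  rw [inner_sub_left] at h1 h2
  rw [abs_le] at h1 h2
  have e : u * (6 * radiusEstimate p C / Real.sqrt D) - (inner ℝ z₀ v - median C v) =
      splitPoint C p v u - inner ℝ z₀ v := by rw [splitPoint]; ring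
  rw [e, abs_le]
  constructor <;> linarith [hz.2, hz'.2]

/-- The probability that a split cuts the set `U` is at most the expected width of the projection of
`U`, divided by the half-length of the interval of split points. -/
lemma nodeLaw_both_meet_le {D : ℕ} {C V : Finset (EuclideanSpace ℝ (Fin D))}
    {U : Set (EuclideanSpace ℝ (Fin D))} {p : EuclideanSpace ℝ (Fin D)}
    (z₀ : EuclideanSpace ℝ (Fin D)) (hV : ∀ z ∈ C, z ∈ U → z ∈ V)
    (hs : 0 < 6 * radiusEstimate p C / Real.sqrt D) :
    (nodeLaw D).real {y | Meets (child C y.1 (splitPoint C p y.1 y.2) true) U ∧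
        Meets (child C y.1 (splitPoint C p y.1 y.2) false) U} ≤
      (∫ v, projWidth V z₀ v ∂(directionLaw D)) / (6 * radiusEstimate p C / Real.sqrt D) := by
  set s := 6 * radiusEstimate p C / Real.sqrt D with hs'
  have hW0 : 0 ≤ ∫ v, projWidth V z₀ v ∂(directionLaw D) :=
    integral_nonneg fun v => projWidth_nonneg _ _ _
  let A : Set (EuclideanSpace ℝ (Fin D) × ℝ) :=
    {y | |y.2 * s - (inner ℝ z₀ y.1 - median C y.1)| ≤ projWidth V z₀ y.1}
  have hA : MeasurableSet A := measurableSet_le (by fun_prop) (by fun_prop)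
  rw [measureReal_def]
  refine ENNReal.toReal_le_of_le_ofReal (by positivity) ?_
  calc nodeLaw D {y | Meets (child C y.1 (splitPoint C p y.1 y.2) true) U ∧
        Meets (child C y.1 (splitPoint C p y.1 y.2) false) U}
      ≤ nodeLaw D A := measure_mono fun y hy => abs_splitPoint_sub_le hV hy.1 hy.2
    _ = ∫⁻ v, offsetLaw (Prod.mk v ⁻¹' A) ∂(directionLaw D) := Measure.prod_apply hA
    _ ≤ ∫⁻ v, ENNReal.ofReal (projWidth V z₀ v / s) ∂(directionLaw D) :=
        lintegral_mono fun v =>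
          offsetLaw_abs_sub_le (inner ℝ z₀ v - median C v) (projWidth V z₀ v) hs
    _ = ENNReal.ofReal ((∫ v, projWidth V z₀ v ∂(directionLaw D)) / s) := by
        rw [← integral_div, ofReal_integral_eq_lintegral_ofReal
          ((integrable_projWidth V z₀).div_const _)
          (Filter.Eventually.of_forall fun v =>
            div_nonneg (projWidth_nonneg _ _ _) hs.le)]

/-- A split of a cell of the doubling set `S` cuts a ball of radius `ρ` with probability
`O(d ρ / Δ)`, where `Δ` is the radius of the cell. -/
lemma nodeLaw_cut_le {D d : ℕ} (hd : 0 < d) {S C : Finset (EuclideanSpace ℝ (Fin D))}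
    (hS : DoublingDimLE (S : Set (EuclideanSpace ℝ (Fin D))) d) (hCS : C ⊆ S)
    {x p : EuclideanSpace ℝ (Fin D)} {ρ : ℝ} (hρ : 0 < ρ) (hC : 0 < radius C) :
    (nodeLaw D).real {y | Meets (child C y.1 (splitPoint C p y.1 y.2) true)
          (Metric.closedBall x ρ) ∧
        Meets (child C y.1 (splitPoint C p y.1 y.2) false) (Metric.closedBall x ρ)} ≤
      64 * d * ρ / radius C := by
  classical
  have hD := dim_pos_of_radius_pos hC
  have hD' : 0 < Real.sqrt D := Real.sqrt_pos.2 (by exact_mod_cast hD)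
  have hest := radius_le_radiusEstimate p C
  have hest0 : 0 < radiusEstimate p C := hC.trans_le hest
  by_cases hm : Meets C (Metric.closedBall x ρ)
  · obtain ⟨z₀, hz₀, hz₀x⟩ := hm
    rw [Metric.mem_closedBall] at hz₀x
    refine (nodeLaw_both_meet_le (V := S.filter fun z => dist z z₀ ≤ 2 * ρ) z₀ ?_
      (by positivity)).trans ?_
    · intro z hz hzx
      rw [Metric.mem_closedBall] at hzx
      refine Finset.mem_filter.2 ⟨hCS hz, ?_⟩
      linarith [dist_triangle_right z z₀ x]
    · have h := integral_projWidth_le hd hS (hCS hz₀) (ρ := 2 * ρ) (by linarith)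
        (U := S.filter fun z => dist z z₀ ≤ 2 * ρ) (fun z hz => Finset.mem_filter.1 hz) hD
      calc _ ≤ (192 * d * (2 * ρ) / Real.sqrt D) / (6 * radiusEstimate p C / Real.sqrt D) := by
            gcongr
        _ = 64 * d * ρ / radiusEstimate p C := by field_simp; ring
        _ ≤ 64 * d * ρ / radius C := by gcongr
  · have : {y : EuclideanSpace ℝ (Fin D) × ℝ |
        Meets (child C y.1 (splitPoint C p y.1 y.2) true) (Metric.closedBall x ρ) ∧
        Meets (child C y.1 (splitPoint C p y.1 y.2) false) (Metric.closedBall x ρ)} = ∅ := by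
      ext y
      simp only [Set.mem_ofPred_eq, Set.mem_empty_iff_false, iff_false]
      exact fun h => hm (h.1.mono (child_subset _ _ _ _))
    rw [this]
    simp only [measureReal_empty]
    positivity

/-! ### Separation of two distant balls by a random split -/

open Classical in
/-- The indicator of the cells that have points in both `U₁` and `U₂`. -/
noncomputable def meetsBoth {D : ℕ} (U₁ U₂ : Set (EuclideanSpace ℝ (Fin D)))
    (C : Finset (EuclideanSpace ℝ (Fin D))) : ℝ :=
  if Meets C U₁ ∧ Meets C U₂ then 1 else 0

lemma meetsBoth_nonneg {D : ℕ} (U₁ U₂ : Set (EuclideanSpace ℝ (Fin D)))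
    (C : Finset (EuclideanSpace ℝ (Fin D))) : 0 ≤ meetsBoth U₁ U₂ C := by
  unfold meetsBoth; split_ifs <;> norm_num

/-- If the split point falls strictly between the projections of `C ∩ U₁` and `C ∩ U₂`, then no
child has points in both sets. -/
lemma not_meets_both_of_between {D : ℕ} {C V₁ V₂ : Finset (EuclideanSpace ℝ (Fin D))}
    {U₁ U₂ : Set (EuclideanSpace ℝ (Fin D))} {z₁ z₂ v : EuclideanSpace ℝ (Fin D)} {t : ℝ}
    (hV₁ : ∀ z ∈ C, z ∈ U₁ → z ∈ V₁) (hV₂ : ∀ z ∈ C, z ∈ U₂ → z ∈ V₂)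
    (h₁ : inner ℝ z₁ v + projWidth V₁ z₁ v < t) (h₂ : t < inner ℝ z₂ v - projWidth V₂ z₂ v)
    (b : Bool) : ¬ (Meets (child C v t b) U₁ ∧ Meets (child C v t b) U₂) := by
  rintro ⟨⟨y₁, hy₁, hU₁⟩, ⟨y₂, hy₂, hU₂⟩⟩
  have a₁ := abs_inner_le_projWidth (z₀ := z₁) (v := v) (hV₁ y₁ (child_subset _ _ _ _ hy₁) hU₁)
  have a₂ := abs_inner_le_projWidth (z₀ := z₂) (v := v) (hV₂ y₂ (child_subset _ _ _ _ hy₂) hU₂)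
  rw [inner_sub_left, abs_le] at a₁ a₂
  cases b
  · have := (Finset.mem_filter.1 hy₁).2
    linarith
  · have := (Finset.mem_filter.1 hy₂).2
    linarith

/-- The choices for which the split point falls strictly between the projections of the sets `V₁`
around `z₁`, below, and `V₂` around `z₂`, above. -/
def between {D : ℕ} (C : Finset (EuclideanSpace ℝ (Fin D))) (p : EuclideanSpace ℝ (Fin D))
    (V₁ V₂ : Finset (EuclideanSpace ℝ (Fin D))) (z₁ z₂ : EuclideanSpace ℝ (Fin D)) :
    Set (EuclideanSpace ℝ (Fin D) × ℝ) :=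
  {y | inner ℝ z₁ y.1 + projWidth V₁ z₁ y.1 < splitPoint C p y.1 y.2} ∩
    {y | splitPoint C p y.1 y.2 < inner ℝ z₂ y.1 - projWidth V₂ z₂ y.1}

lemma measurableSet_between {D : ℕ} (C : Finset (EuclideanSpace ℝ (Fin D)))
    (p : EuclideanSpace ℝ (Fin D)) (V₁ V₂ : Finset (EuclideanSpace ℝ (Fin D)))
    (z₁ z₂ : EuclideanSpace ℝ (Fin D)) : MeasurableSet (between C p V₁ V₂ z₁ z₂) :=
  (measurableSet_lt (by fun_prop) (by fun_prop)).inter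
    (measurableSet_lt (by fun_prop) (by fun_prop))

/-- The split point falls between the projections of two distant small balls with probability
bounded below. -/
lemma le_nodeLaw_between {D : ℕ} {C V₁ V₂ : Finset (EuclideanSpace ℝ (Fin D))}
    {p z₁ z₂ : EuclideanSpace ℝ (Fin D)} {Δ : ℝ} (hΔ : 0 < Δ) (hD : 0 < D)
    (hest1 : Δ / 2 ≤ radiusEstimate p C) (hest2 : radiusEstimate p C ≤ 2 * Δ)
    (hz₁ : z₁ ∈ C) (hz₂ : z₂ ∈ C) (hfar : Δ / 4 ≤ dist z₁ z₂)
    (hW₁ : ∫ v, projWidth V₁ z₁ v ∂(directionLaw D) ≤ Δ / 10 ^ 4 / Real.sqrt D)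
    (hW₂ : ∫ v, projWidth V₂ z₂ v ∂(directionLaw D) ≤ Δ / 10 ^ 4 / Real.sqrt D) :
    1 / 5760 ≤ (nodeLaw D).real (between C p V₁ V₂ z₁ z₂ ∪ between C p V₂ V₁ z₂ z₁) := by
  have hD' : 0 < Real.sqrt D := Real.sqrt_pos.2 (by exact_mod_cast hD)
  set q := radiusEstimate p C / Real.sqrt D with hq
  set e := Δ / Real.sqrt D with he
  have he0 : 0 < e := by positivity
  have hq1 : e / 2 ≤ q := by rw [hq, he, div_right_comm]; gcongr
  have hq2 : q ≤ 2 * e := by rw [hq, he, ← mul_div_assoc]; gcongr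
  -- The exceptional directions.
  let B₁ : Set (EuclideanSpace ℝ (Fin D)) := {v | 3 * q < |median C v - inner ℝ p v|}
  let B₂ : Set (EuclideanSpace ℝ (Fin D)) := {v | 3 * q < |inner ℝ (z₁ - p) v|}
  let B₃ : Set (EuclideanSpace ℝ (Fin D)) := {v | 3 * q < |inner ℝ (z₂ - p) v|}
  let B₄ : Set (EuclideanSpace ℝ (Fin D)) := {v | |inner ℝ (z₁ - z₂) v| < e / 40}
  let B₅ : Set (EuclideanSpace ℝ (Fin D)) := {v | e / 160 ≤ projWidth V₁ z₁ v}
  let B₆ : Set (EuclideanSpace ℝ (Fin D)) := {v | e / 160 ≤ projWidth V₂ z₂ v}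
  have m₁ : MeasurableSet B₁ := measurableSet_lt (by fun_prop) (by fun_prop)
  have m₂ : MeasurableSet B₂ := measurableSet_lt (by fun_prop) (by fun_prop)
  have m₃ : MeasurableSet B₃ := measurableSet_lt (by fun_prop) (by fun_prop)
  have m₄ : MeasurableSet B₄ := measurableSet_lt (by fun_prop) (by fun_prop)
  have m₅ : MeasurableSet B₅ := measurableSet_le (by fun_prop) (by fun_prop)
  have m₆ : MeasurableSet B₆ := measurableSet_le (by fun_prop) (by fun_prop)
  have b₁ : (directionLaw D).real B₁ ≤ 2 / 9 := directionLaw_median_le ⟨z₁, hz₁⟩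
  have cheb : ∀ z ∈ C, (directionLaw D).real {v | 3 * q < |inner ℝ (z - p) v|} ≤ 1 / 9 := by
    intro z hz
    refine le_trans (measureReal_mono fun v hv => ?_)
      ((directionLaw_abs_inner_gt_le (z - p) (t := 3) (by norm_num)).trans (by norm_num))
    have hv' : 3 * q < |inner ℝ (z - p) v| := hv
    refine lt_of_le_of_lt ?_ hv'
    rw [hq, ← dist_eq_norm]
    have := dist_le_radiusEstimate (p := p) hz
    gcongr
  have b₂ : (directionLaw D).real B₂ ≤ 1 / 9 := cheb z₁ hz₁
  have b₃ : (directionLaw D).real B₃ ≤ 1 / 9 := cheb z₂ hz₂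
  have b₄ : (directionLaw D).real B₄ ≤ 1 / 10 := by
    refine le_trans (measureReal_mono fun v hv => ?_)
      (directionLaw_abs_inner_lt_le (z₁ - z₂) (t := 1 / 10) (by norm_num))
    have hv' : |inner ℝ (z₁ - z₂) v| < e / 40 := hv
    refine hv'.trans_le ?_
    rw [← dist_eq_norm, he]
    calc Δ / Real.sqrt D / 40 = 1 / 10 * (Δ / 4 / Real.sqrt D) := by ring
      _ ≤ _ := by gcongr
  have markov : ∀ (V : Finset (EuclideanSpace ℝ (Fin D))) (z : EuclideanSpace ℝ (Fin D)),
      ∫ v, projWidth V z v ∂(directionLaw D) ≤ Δ / 10 ^ 4 / Real.sqrt D →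
      (directionLaw D).real {v | e / 160 ≤ projWidth V z v} ≤ 1 / 60 := by
    intro V z h
    have hm := mul_meas_ge_le_integral_of_nonneg (μ := directionLaw D) (f := projWidth V z)
      (Filter.Eventually.of_forall fun v => projWidth_nonneg _ _ _)
      (integrable_projWidth V z) (e / 160)
    have h1 := hm.trans h
    rw [show Δ / 10 ^ 4 / Real.sqrt D = e / 10 ^ 4 by rw [he]; ring] at h1
    have h2 : (e / 160) * (directionLaw D).real {v | e / 160 ≤ projWidth V z v} ≤
        (e / 160) * (1 / 60) := h1.trans (by linarith)
    exact le_of_mul_le_mul_left h2 (by positivity)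
  have b₅ : (directionLaw D).real B₅ ≤ 1 / 60 := markov _ _ hW₁
  have b₆ : (directionLaw D).real B₆ ≤ 1 / 60 := markov _ _ hW₂
  set B := B₁ ∪ (B₂ ∪ (B₃ ∪ (B₄ ∪ (B₅ ∪ B₆)))) with hB
  have mB : MeasurableSet B := m₁.union (m₂.union (m₃.union (m₄.union (m₅.union m₆))))
  have bB : (directionLaw D).real B ≤ 2 / 3 := by
    have c₁ := measureReal_union_le (μ := directionLaw D) B₁ (B₂ ∪ (B₃ ∪ (B₄ ∪ (B₅ ∪ B₆))))
    have c₂ := measureReal_union_le (μ := directionLaw D) B₂ (B₃ ∪ (B₄ ∪ (B₅ ∪ B₆)))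
    have c₃ := measureReal_union_le (μ := directionLaw D) B₃ (B₄ ∪ (B₅ ∪ B₆))
    have c₄ := measureReal_union_le (μ := directionLaw D) B₄ (B₅ ∪ B₆)
    have c₅ := measureReal_union_le (μ := directionLaw D) B₅ B₆
    linarith
  have bG : 1 / 3 ≤ (directionLaw D).real Bᶜ := by
    rw [probReal_compl_eq_one_sub mB]
    linarith
  set s := 6 * radiusEstimate p C / Real.sqrt D with hs
  have hsq : s = 6 * q := by rw [hs, hq]; ring
  have hs0 : 0 < s := by rw [hsq]; linarith
  have hs12 : s ≤ 12 * e := by rw [hsq]; linarith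
  set A : Set (EuclideanSpace ℝ (Fin D) × ℝ) := 
    between C p V₁ V₂ z₁ z₂ ∪ between C p V₂ V₁ z₂ z₁ with hA
  have mA : MeasurableSet A := (measurableSet_between ..).union (measurableSet_between ..)
  have hpt : ∀ v ∈ Bᶜ, ENNReal.ofReal (1 / 1920) ≤ offsetLaw (Prod.mk v ⁻¹' A) := by
    intro v hv
    simp only [hB, Set.compl_union, Set.mem_inter_iff, Set.mem_compl_iff, B₁, B₂, B₃, B₄, B₅, B₆,
      Set.mem_ofPred_eq, not_lt, not_le] at hv
    obtain ⟨g₁, g₂, g₃, g₄, g₅, g₆⟩ := hv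
    rw [inner_sub_left] at g₂ g₃ g₄
    rw [abs_le] at g₁ g₂ g₃
    have key : ∀ lo hi : ℝ, median C v - s ≤ lo → hi ≤ median C v + s → e / 80 ≤ hi - lo →
        {u | lo < median C v + u * s ∧ median C v + u * s < hi} ⊆ Prod.mk v ⁻¹' A →
        ENNReal.ofReal (1 / 1920) ≤ offsetLaw (Prod.mk v ⁻¹' A) := by
      intro lo hi h1 h2 h3 h4
      refine le_trans ?_ ((le_offsetLaw_Ioo hs0 h1 h2).trans (measure_mono h4))
      apply ENNReal.ofReal_le_ofReal
      rw [le_div_iff₀ (by positivity)]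
      linarith
    have w₁ := projWidth_nonneg V₁ z₁ v
    have w₂ := projWidth_nonneg V₂ z₂ v
    rcases le_abs.1 g₄ with h | h
    · refine key (inner ℝ z₂ v + projWidth V₂ z₂ v) (inner ℝ z₁ v - projWidth V₁ z₁ v)
        (by linarith) (by linarith) (by linarith) fun u hu => Or.inr ?_
      exact hu
    · refine key (inner ℝ z₁ v + projWidth V₁ z₁ v) (inner ℝ z₂ v - projWidth V₂ z₂ v)
        (by linarith) (by linarith) (by linarith) fun u hu => Or.inl ?_
      exact hu
  have hfinal : ENNReal.ofReal (1 / 5760) ≤ nodeLaw D A := by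
    calc ENNReal.ofReal (1 / 5760)
        = ENNReal.ofReal (1 / 1920) * ENNReal.ofReal (1 / 3) := by
          rw [← ENNReal.ofReal_mul (by norm_num)]; norm_num
      _ ≤ ENNReal.ofReal (1 / 1920) * directionLaw D Bᶜ := by
          gcongr
          exact ENNReal.ofReal_le_of_le_toReal bG
      _ = ∫⁻ _ in Bᶜ, ENNReal.ofReal (1 / 1920) ∂(directionLaw D) := by
          rw [setLIntegral_const]
      _ ≤ ∫⁻ v in Bᶜ, offsetLaw (Prod.mk v ⁻¹' A) ∂(directionLaw D) :=
          setLIntegral_mono' mB.compl hpt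
      _ ≤ ∫⁻ v, offsetLaw (Prod.mk v ⁻¹' A) ∂(directionLaw D) := setLIntegral_le_lintegral _ _
      _ = nodeLaw D A := (Measure.prod_apply mA).symm
  exact (ENNReal.ofReal_le_iff_le_toReal (measure_ne_top _ _)).1 hfinal

/-- The expected number of children that have points in both of two distant small balls is less than
`1` by a constant: a split that separates the balls is more likely than one that cuts the first
ball, which is the only way to get two such children. -/
lemma integral_meetsBoth_children_le {D d : ℕ} (hd : 0 < d)
    {S C : Finset (EuclideanSpace ℝ (Fin D))}
    (hS : DoublingDimLE (S : Set (EuclideanSpace ℝ (Fin D))) d) (hCS : C ⊆ S)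
    {p a b : EuclideanSpace ℝ (Fin D)} (hp : p ∈ C) {Δ ρ : ℝ} (hΔ : 0 < Δ) (hρ : 0 < ρ)
    (hρΔ : 2 ^ 22 * d * ρ ≤ Δ) (hr1 : Δ / 2 < radius C) (hr2 : radius C ≤ Δ)
    (hab : Δ / 2 - 2 * ρ ≤ dist a b) :
    ∫ y, (meetsBoth (Metric.closedBall a ρ) (Metric.closedBall b ρ)
          (child C y.1 (splitPoint C p y.1 y.2) true) +
        meetsBoth (Metric.closedBall a ρ) (Metric.closedBall b ρ)
          (child C y.1 (splitPoint C p y.1 y.2) false)) ∂(nodeLaw D) ≤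
      (1 - 1 / 10 ^ 4) * meetsBoth (Metric.closedBall a ρ) (Metric.closedBall b ρ) C := by
  classical
  have hd' : (1 : ℝ) ≤ d := by exact_mod_cast hd
  set U₁ := Metric.closedBall a ρ with hU₁
  set U₂ := Metric.closedBall b ρ with hU₂
  by_cases hm : Meets C U₁ ∧ Meets C U₂
  swap
  · have h0 : ∀ (v : EuclideanSpace ℝ (Fin D)) (t : ℝ) (i : Bool),
        meetsBoth U₁ U₂ (child C v t i) = 0 := by
      intro v t i
      rw [meetsBoth, if_neg]
      exact fun h => hm ⟨h.1.mono (child_subset _ _ _ _), h.2.mono (child_subset _ _ _ _)⟩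
    rw [meetsBoth, if_neg hm]
    simp [h0]
  rw [meetsBoth, if_pos hm, mul_one]
  obtain ⟨⟨z₁, hz₁, hz₁U⟩, ⟨z₂, hz₂, hz₂U⟩⟩ := hm
  rw [hU₁, Metric.mem_closedBall] at hz₁U
  rw [hU₂, Metric.mem_closedBall] at hz₂U
  have hC : 0 < radius C := by linarith
  have hD := dim_pos_of_radius_pos hC
  have hD' : 0 < Real.sqrt D := Real.sqrt_pos.2 (by exact_mod_cast hD)
  have hest1 : Δ / 2 ≤ radiusEstimate p C := hr1.le.trans (radius_le_radiusEstimate p C)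
  have hest2 : radiusEstimate p C ≤ 2 * Δ := (radiusEstimate_le hp).trans (by linarith)
  have hest0 : 0 < radiusEstimate p C := by linarith
  have hρ16 : 16 * ρ ≤ Δ := by nlinarith
  let V : EuclideanSpace ℝ (Fin D) → Finset (EuclideanSpace ℝ (Fin D)) :=
    fun z => S.filter fun z' => dist z' z ≤ 2 * ρ
  have hV₁ : ∀ z ∈ C, z ∈ U₁ → z ∈ V z₁ := by
    intro z hz hzU
    rw [hU₁, Metric.mem_closedBall] at hzU
    refine Finset.mem_filter.2 ⟨hCS hz, ?_⟩
    linarith [dist_triangle_right z z₁ a]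
  have hV₂ : ∀ z ∈ C, z ∈ U₂ → z ∈ V z₂ := by
    intro z hz hzU
    rw [hU₂, Metric.mem_closedBall] at hzU
    refine Finset.mem_filter.2 ⟨hCS hz, ?_⟩
    linarith [dist_triangle_right z z₂ b]
  have hW : ∀ z ∈ C, ∫ v, projWidth (V z) z v ∂(directionLaw D) ≤ Δ / 10 ^ 4 / Real.sqrt D := by
    intro z hz
    refine (integral_projWidth_le hd hS (hCS hz) (ρ := 2 * ρ) (by linarith)
      (fun z' hz' => Finset.mem_filter.1 hz') hD).trans ?_
    gcongr
    linarith
  have hfar : Δ / 4 ≤ dist z₁ z₂ := by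
    have h1 := dist_triangle4 a z₁ z₂ b
    rw [dist_comm a z₁] at h1
    linarith
  have hsep := le_nodeLaw_between hΔ hD hest1 hest2 hz₁ hz₂ hfar (hW z₁ hz₁) (hW z₂ hz₂)
  have hcut := nodeLaw_both_meet_le (p := p) (V := V z₁) (U := U₁) z₁ hV₁
    (by positivity : 0 < 6 * radiusEstimate p C / Real.sqrt D)
  have hcut' : (∫ v, projWidth (V z₁) z₁ v ∂(directionLaw D)) /
      (6 * radiusEstimate p C / Real.sqrt D) ≤ 1 / 25000 := by
    rw [div_le_iff₀ (by positivity)]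
    refine (hW z₁ hz₁).trans ?_
    rw [← mul_div_assoc]
    gcongr
    linarith
  set A : Set (EuclideanSpace ℝ (Fin D) × ℝ) := 
    between C p (V z₁) (V z₂) z₁ z₂ ∪ between C p (V z₂) (V z₁) z₂ z₁ with hA
  have mA : MeasurableSet A := (measurableSet_between ..).union (measurableSet_between ..)
  set A' : Set (EuclideanSpace ℝ (Fin D) × ℝ) :=
    {y | Meets (child C y.1 (splitPoint C p y.1 y.2) true) U₁ ∧
      Meets (child C y.1 (splitPoint C p y.1 y.2) false) U₁} with hA'
  have mA' : MeasurableSet A' :=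
    measurableSet_setOfPred.2 (measurable_children C p fun L R => Meets L U₁ ∧ Meets R U₁)
  have hpt : ∀ y : EuclideanSpace ℝ (Fin D) × ℝ,
      meetsBoth U₁ U₂ (child C y.1 (splitPoint C p y.1 y.2) true) +
        meetsBoth U₁ U₂ (child C y.1 (splitPoint C p y.1 y.2) false) ≤
      1 + A'.indicator 1 y - A.indicator 1 y := by
    intro y
    by_cases hyA : y ∈ A
    · have h0 : ∀ i, meetsBoth U₁ U₂ (child C y.1 (splitPoint C p y.1 y.2) i) = 0 := by
        intro i
        rw [meetsBoth, if_neg]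
        rcases hyA with h | h
        · exact not_meets_both_of_between hV₁ hV₂ h.1 h.2 i
        · rw [and_comm]
          exact not_meets_both_of_between hV₂ hV₁ h.1 h.2 i
      have : 0 ≤ A'.indicator (1 : EuclideanSpace ℝ (Fin D) × ℝ → ℝ) y :=
        Set.indicator_nonneg (fun _ _ => zero_le_one) y
      rw [h0, h0, Set.indicator_of_mem hyA, Pi.one_apply]
      linarith
    · rw [Set.indicator_of_notMem hyA]
      by_cases hyA' : y ∈ A'
      · rw [Set.indicator_of_mem hyA', Pi.one_apply, meetsBoth, meetsBoth]
        split_ifs <;> norm_num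
      · rw [Set.indicator_of_notMem hyA', meetsBoth, meetsBoth]
        split_ifs with h1 h2 <;> norm_num
        exact hyA' ⟨h1.1, h2.1⟩
  have iA : Integrable (A.indicator (1 : EuclideanSpace ℝ (Fin D) × ℝ → ℝ)) (nodeLaw D) :=
    (integrable_const 1).indicator mA
  have iA' : Integrable (A'.indicator (1 : EuclideanSpace ℝ (Fin D) × ℝ → ℝ)) (nodeLaw D) :=
    (integrable_const 1).indicator mA'
  calc _ ≤ ∫ y, (1 + A'.indicator 1 y - A.indicator 1 y) ∂(nodeLaw D) :=
        integral_mono (integrable_children C p fun L R => meetsBoth U₁ U₂ L + meetsBoth U₁ U₂ R)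
          (((integrable_const 1).add iA').sub iA) hpt
    _ = 1 + (nodeLaw D).real A' - (nodeLaw D).real A := by
        rw [integral_sub (f := fun y => 1 + A'.indicator 1 y) ((integrable_const 1).add iA') iA,
          integral_add (integrable_const 1) iA', integral_indicator_one mA,
          integral_indicator_one mA', integral_const, probReal_univ, one_smul]
    _ ≤ 1 - 1 / 10 ^ 4 := by
        norm_num at hsep hcut hcut' ⊢
        linarith

/-! ### The potential of a cell at one scale -/

/-- At scale `Δ`, a cell of a `d`-dimensional set meets at most `2 ^ (d * netExponent d)` of the
balls around a net of mesh `Δ / O(d)`. -/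
def netExponent (d : ℕ) : ℕ := 25 + Nat.clog 2 d

/-- For every scale `Δ` there is a potential, the number of pairs of distant balls around the points
of a net that the cell meets: it is at least `1` and at most `d ^ O(d)` on the cells whose radius is in
`(Δ / 2, Δ]`, and its expected sum over the two children of such a cell is smaller than
its value at the cell by a constant factor. -/
lemma exists_potential {D d : ℕ} (hd : 0 < d) {S : Finset (EuclideanSpace ℝ (Fin D))}
    (hS : DoublingDimLE (S : Set (EuclideanSpace ℝ (Fin D))) d) {Δ : ℝ} (hΔ : 0 < Δ) :
    ∃ h : Finset (EuclideanSpace ℝ (Fin D)) → ℝ,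
      (∀ C, 0 ≤ h C) ∧
      (∀ C ⊆ S, Δ / 2 < radius C → 1 ≤ h C) ∧
      (∀ C ⊆ S, radius C ≤ Δ → h C ≤ (2 ^ (d * netExponent d)) ^ 2) ∧
      ∀ C ⊆ S, ∀ p ∈ C, Δ / 2 < radius C → radius C ≤ Δ →
        ∫ y, (h (child C y.1 (splitPoint C p y.1 y.2) true) +
          h (child C y.1 (splitPoint C p y.1 y.2) false)) ∂(nodeLaw D) ≤
        (1 - 1 / 10 ^ 4) * h C := by
  classical
  set m := 22 + Nat.clog 2 d with hm
  have hdm : (2 : ℝ) ^ 22 * d ≤ 2 ^ m := by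
    rw [hm, pow_add]
    have : d ≤ 2 ^ Nat.clog 2 d := Nat.le_pow_clog (by norm_num) d
    have : (d : ℝ) ≤ 2 ^ Nat.clog 2 d := by exact_mod_cast this
    gcongr
  set ρ := Δ / 2 ^ m with hρdef
  have hρ : 0 < ρ := by positivity
  have hρΔ : 2 ^ 22 * d * ρ ≤ Δ := by
    rw [hρdef, ← mul_div_assoc, div_le_iff₀ (by positivity), mul_comm Δ]
    gcongr
  have hρle : ρ ≤ Δ := div_le_self hΔ.le (one_le_pow₀ (by norm_num))
  obtain ⟨T, hTS, hsep, hnet⟩ := exists_separated_net S hρ.le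
  let pairs := (T ×ˢ T).filter fun q => Δ / 2 - 2 * ρ ≤ dist q.1 q.2
  let h : Finset (EuclideanSpace ℝ (Fin D)) → ℝ := fun C =>
    ∑ q ∈ pairs, meetsBoth (Metric.closedBall q.1 ρ) (Metric.closedBall q.2 ρ) C
  refine ⟨h, fun C => Finset.sum_nonneg fun _ _ => meetsBoth_nonneg _ _ _, ?_, ?_, ?_⟩
  · intro C hCS hC
    obtain ⟨p, hp⟩ := nonempty_of_radius_pos ((by linarith : (0 : ℝ) < Δ / 2).trans hC)
    obtain ⟨y, hy, hyp⟩ := exists_far_of_lt_radius (by linarith) hC p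
    obtain ⟨a, ha, hpa⟩ := hnet p (hCS hp)
    obtain ⟨b, hb, hyb⟩ := hnet y (hCS hy)
    have hab : (a, b) ∈ pairs := by
      refine Finset.mem_filter.2 ⟨Finset.mem_product.2 ⟨ha, hb⟩, ?_⟩
      have := dist_triangle4 p a b y
      rw [dist_comm b y, dist_comm p y] at this
      simp only
      linarith
    have h1 : meetsBoth (Metric.closedBall a ρ) (Metric.closedBall b ρ) C = 1 := by
      have hma : Meets C (Metric.closedBall a ρ) := ⟨p, hp, Metric.mem_closedBall.2 hpa⟩
      have hmb : Meets C (Metric.closedBall b ρ) := ⟨y, hy, Metric.mem_closedBall.2 hyb⟩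
      rw [meetsBoth, if_pos ⟨hma, hmb⟩]
    have h2 : ∑ q ∈ {(a, b)}, meetsBoth (Metric.closedBall q.1 ρ) (Metric.closedBall q.2 ρ) C ≤
        h C :=
      Finset.sum_le_sum_of_subset_of_nonneg (Finset.singleton_subset_iff.2 hab)
        fun _ _ _ => meetsBoth_nonneg _ _ _
    rwa [Finset.sum_singleton, h1] at h2
  · intro C hCS hC
    obtain ⟨c, hc⟩ := exists_center_of_radius_lt (C := C) (ρ := 2 * Δ) (by linarith)
    let A := T.filter fun a => Meets C (Metric.closedBall a ρ)
    have hA : A.card ≤ 2 ^ (d * netExponent d) := by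
      refine hS.card_separated_le (netExponent d) c (ρ := 3 * Δ) (by linarith) A ?_ ?_
      · intro a ha
        obtain ⟨haT, z, hz, hza⟩ := Finset.mem_filter.1 ha
        refine ⟨hTS haT, ?_⟩
        rw [Metric.mem_closedBall, dist_comm] at hza
        linarith [dist_triangle a z c, hc z hz]
      · intro a ha b hb hne
        refine lt_of_le_of_lt ?_ (hsep a (Finset.mem_filter.1 ha).1 b (Finset.mem_filter.1 hb).1 hne)
        rw [hρdef, show netExponent d = m + 3 by rw [netExponent, hm]; ring, pow_add,
          ← mul_div_assoc, div_le_div_iff₀ (by positivity) (by positivity)]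
        have : 0 < Δ * 2 ^ m := by positivity
        linarith
    calc h C ≤ ∑ q ∈ pairs, if q ∈ A ×ˢ A then 1 else 0 := by
          refine Finset.sum_le_sum fun q hq => ?_
          obtain ⟨hqT, -⟩ := Finset.mem_filter.1 hq
          rw [Finset.mem_product] at hqT
          unfold meetsBoth
          by_cases hmeet : Meets C (Metric.closedBall q.1 ρ) ∧ Meets C (Metric.closedBall q.2 ρ)
          · rw [if_pos hmeet, if_pos]
            exact Finset.mem_product.2 ⟨Finset.mem_filter.2 ⟨hqT.1, hmeet.1⟩,
              Finset.mem_filter.2 ⟨hqT.2, hmeet.2⟩⟩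
          · rw [if_neg hmeet]; split_ifs <;> norm_num
      _ = ((pairs.filter fun q => q ∈ A ×ˢ A).card : ℝ) := by
          rw [Finset.sum_ite, Finset.sum_const_zero, add_zero, Finset.sum_const, nsmul_one]
      _ ≤ ((A ×ˢ A).card : ℝ) := by
          exact_mod_cast Finset.card_le_card fun q hq => (Finset.mem_filter.1 hq).2
      _ ≤ (2 ^ (d * netExponent d)) ^ 2 := by
          rw [Finset.card_product, sq]
          push_cast
          have : (A.card : ℝ) ≤ 2 ^ (d * netExponent d) := by exact_mod_cast hA
          gcongr
  · intro C hCS p hp hr1 hr2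
    simp only [h, ← Finset.sum_add_distrib]
    rw [integral_finsetSum _ fun q _ => integrable_children C p fun L R =>
      meetsBoth (Metric.closedBall q.1 ρ) (Metric.closedBall q.2 ρ) L +
        meetsBoth (Metric.closedBall q.1 ρ) (Metric.closedBall q.2 ρ) R, Finset.mul_sum]
    refine Finset.sum_le_sum fun q hq => ?_
    exact integral_meetsBoth_children_le hd hS hCS hp hΔ hρ hρΔ hr1 hr2 (Finset.mem_filter.1 hq).2

/-! ### Scales -/

/-- The least `j` such that the radius of the cell is at most `2 ^ j * r`. -/
noncomputable def scale {D : ℕ} (r : ℝ) (C : Finset (EuclideanSpace ℝ (Fin D))) : ℕ :=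
  Nat.clog 2 ⌈radius C / r⌉₊

lemma scale_le_iff {D : ℕ} {r : ℝ} (hr : 0 < r) {C : Finset (EuclideanSpace ℝ (Fin D))} {j : ℕ} :
    scale r C ≤ j ↔ radius C ≤ 2 ^ j * r := by
  rw [scale, Nat.clog_le_iff_le_pow (by norm_num), Nat.ceil_le, div_le_iff₀ hr]
  push_cast
  rfl

lemma scale_mono {D : ℕ} {r : ℝ} (hr : 0 < r) {C C' : Finset (EuclideanSpace ℝ (Fin D))}
    (h : C' ⊆ C) : scale r C' ≤ scale r C :=
  (scale_le_iff hr).2 ((radius_mono h).trans ((scale_le_iff hr).1 le_rfl))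

lemma scale_pos_iff {D : ℕ} {r : ℝ} (hr : 0 < r) {C : Finset (EuclideanSpace ℝ (Fin D))} :
    0 < scale r C ↔ r < radius C := by
  rw [← not_le, scale_le_iff hr, pow_zero, one_mul, not_le]

lemma radius_le_of_scale {D : ℕ} {r : ℝ} (hr : 0 < r) (C : Finset (EuclideanSpace ℝ (Fin D))) :
    radius C ≤ 2 ^ scale r C * r := (scale_le_iff hr).1 le_rfl

lemma lt_radius_of_scale {D : ℕ} {r : ℝ} (hr : 0 < r) {C : Finset (EuclideanSpace ℝ (Fin D))}
    (hC : 0 < scale r C) : 2 ^ scale r C * r / 2 < radius C := by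
  have h : ¬ scale r C ≤ scale r C - 1 := by omega
  rw [scale_le_iff hr, not_le] at h
  obtain ⟨j, hj⟩ : ∃ j, scale r C = j + 1 := ⟨scale r C - 1, by omega⟩
  rw [hj, Nat.add_sub_cancel] at h
  rw [hj, pow_succ]
  linarith

/-- Potentials as in `exists_potential`, for all the scales `2 ^ j * r`. -/
structure ScalePotential {D : ℕ} (S : Finset (EuclideanSpace ℝ (Fin D))) (d : ℕ) (r : ℝ) where
  /-- The potential of a cell at the scale `2 ^ j * r`. -/
  h : ℕ → Finset (EuclideanSpace ℝ (Fin D)) → ℝ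
  nonneg : ∀ j C, 0 ≤ h j C
  one_le : ∀ j, ∀ C ⊆ S, 2 ^ j * r / 2 < radius C → 1 ≤ h j C
  le : ∀ j, ∀ C ⊆ S, radius C ≤ 2 ^ j * r → h j C ≤ (2 ^ (d * netExponent d)) ^ 2
  contract : ∀ j, ∀ C ⊆ S, ∀ p ∈ C, 2 ^ j * r / 2 < radius C → radius C ≤ 2 ^ j * r →
    ∫ y, (h j (child C y.1 (splitPoint C p y.1 y.2) true) +
      h j (child C y.1 (splitPoint C p y.1 y.2) false)) ∂(nodeLaw D) ≤ (1 - 1 / 10 ^ 4) * h j C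

lemma DoublingDimLE.nonempty_scalePotential {D d : ℕ} (hd : 0 < d)
    {S : Finset (EuclideanSpace ℝ (Fin D))}
    (hS : DoublingDimLE (S : Set (EuclideanSpace ℝ (Fin D))) d) {r : ℝ} (hr : 0 < r) :
    Nonempty (ScalePotential S d r) := by
  choose h h1 h2 h3 h4 using fun j : ℕ => exists_potential hd hS (Δ := 2 ^ j * r) (by positivity)
  exact ⟨⟨h, h1, h2, h3, h4⟩⟩

/-! ### The Lyapunov function -/

/-- An upper bound for `1 + log h`, where `h` is the potential of a cell at its scale. -/
noncomputable def logBound (d : ℕ) : ℝ := 1 + 2 * d * netExponent d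

/-- The factor by which the Lyapunov function grows from one scale to the next, for the cells that
are not much larger than the ball. -/
noncomputable def growth (d : ℕ) : ℝ := 3 * 10 ^ 4 * (2 ^ (d * netExponent d)) ^ 2

/-- The cost of the scales on which a cell is much larger than the ball: those above the scale `j`
contribute at most `slope d (R / r) / 2 ^ j`. -/
noncomputable def slope (d : ℕ) (t : ℝ) : ℝ := 256 * 10 ^ 4 * d * t * logBound d

/-- The scale above which a cell counts as large, compared to a ball of radius `t * r`. -/
noncomputable def topScale (d : ℕ) (t : ℝ) : ℕ := Nat.clog 2 ⌈8 * slope d t⌉₊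

/-- The bound for the number of disjoint cells. -/
noncomputable def cellBound (d : ℕ) (t : ℝ) : ℝ :=
  8 * (growth d ^ topScale d t * (2 ^ (d * netExponent d)) ^ 2)

lemma logBound_pos (d : ℕ) : 0 < logBound d := by unfold logBound; positivity

lemma one_le_growth (d : ℕ) : 1 ≤ growth d := by
  have h : (1 : ℝ) ≤ (2 ^ (d * netExponent d)) ^ 2 := one_le_pow₀ (one_le_pow₀ (by norm_num))
  unfold growth
  linarith

lemma one_le_cellBound (d : ℕ) (t : ℝ) : 1 ≤ cellBound d t := by
  have h : (1 : ℝ) ≤ (2 ^ (d * netExponent d)) ^ 2 := one_le_pow₀ (one_le_pow₀ (by norm_num))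
  have h' : 1 ≤ growth d ^ topScale d t := one_le_pow₀ (one_le_growth d)
  unfold cellBound
  nlinarith

lemma slope_nonneg (d : ℕ) {t : ℝ} (ht : 0 ≤ t) : 0 ≤ slope d t := by
  have := logBound_pos d
  unfold slope; positivity

lemma slope_div_two_pow_topScale_le (d : ℕ) (t : ℝ) : slope d t / 2 ^ topScale d t ≤ 1 / 8 := by
  have h1 : 8 * slope d t ≤ 2 ^ topScale d t := by
    refine (Nat.le_ceil _).trans ?_
    have := Nat.le_pow_clog (b := 2) (by norm_num) ⌈8 * slope d t⌉₊
    exact_mod_cast this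
  rw [div_le_iff₀ (by positivity)]
  linarith

open Classical in
/-- The Lyapunov function, `0` on the cells that do not meet the ball `B`. On a cell of radius at
most `2 ^ topScale * r` it bounds the expected number of descendants of radius greater than `r`
that meet `B`, divided by `cellBound`; on a larger cell it bounds in addition the probability that a large
descendant of the cell is split into two parts that both meet `B`. -/
noncomputable def lyapunov {D d : ℕ} {S : Finset (EuclideanSpace ℝ (Fin D))} {r : ℝ}
    (P : ScalePotential S d r) (B : Set (EuclideanSpace ℝ (Fin D))) (t : ℝ)
    (C : Finset (EuclideanSpace ℝ (Fin D))) : ℝ :=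
  if Meets C B then
    if scale r C = 0 then 0
    else if scale r C ≤ topScale d t then
      growth d ^ scale r C * P.h (scale r C) C / cellBound d t
    else
      1 / 8 + slope d t * (1 / 2 ^ topScale d t - 2 / 2 ^ scale r C) +
        slope d t / 2 ^ scale r C * ((1 + Real.log (P.h (scale r C) C)) / logBound d)
  else 0

open Classical in
/-- The cost of a node with cell `C` and children `L`, `L'`: a large cell costs `1` if the split cuts
the ball `B`, another cell of radius greater than `r` costs `1 / cellBound` if it meets `B`. -/
noncomputable def nodeCost {D : ℕ} (d : ℕ) (r : ℝ) (B : Set (EuclideanSpace ℝ (Fin D))) (t : ℝ)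
    (C L L' : Finset (EuclideanSpace ℝ (Fin D))) : ℝ :=
  if topScale d t < scale r C then if Meets L B ∧ Meets L' B then 1 else 0
  else if 0 < scale r C ∧ Meets C B then 1 / cellBound d t else 0

section Drift

variable {D d : ℕ} {S : Finset (EuclideanSpace ℝ (Fin D))} {r : ℝ}
  (P : ScalePotential S d r) (B : Set (EuclideanSpace ℝ (Fin D))) {t : ℝ}
  {C : Finset (EuclideanSpace ℝ (Fin D))}

lemma ScalePotential.one_le_scale (hr : 0 < r) (hC : C ⊆ S) (h0 : 0 < scale r C) :
    1 ≤ P.h (scale r C) C := P.one_le _ C hC (lt_radius_of_scale hr h0)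

lemma ScalePotential.le_scale (hr : 0 < r) (hC : C ⊆ S) :
    P.h (scale r C) C ≤ (2 ^ (d * netExponent d)) ^ 2 := P.le _ C hC (radius_le_of_scale hr C)

lemma ScalePotential.log_le_logBound (hr : 0 < r) (hC : C ⊆ S) (h0 : 0 < scale r C) :
    (1 + Real.log (P.h (scale r C) C)) / logBound d ≤ 1 := by
  rw [div_le_one (logBound_pos d), logBound]
  have h1 := P.one_le_scale hr hC h0
  have h2 := Real.log_le_log (by linarith) (P.le_scale hr hC)
  rw [Real.log_pow, Real.log_pow] at h2
  have h3 : Real.log 2 ≤ 1 := by linarith [Real.log_two_lt_d9]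
  have h4 : (0 : ℝ) ≤ (d * netExponent d : ℕ) := Nat.cast_nonneg _
  have h5 : ((d * netExponent d : ℕ) : ℝ) * Real.log 2 ≤ (d * netExponent d : ℕ) :=
    mul_le_of_le_one_right h4 h3
  push_cast at h2 h5 ⊢
  linarith

lemma lyapunov_of_not_meets (h : ¬ Meets C B) : lyapunov P B t C = 0 := if_neg h

lemma lyapunov_of_scale_eq_zero (h : scale r C = 0) : lyapunov P B t C = 0 := by
  unfold lyapunov; split_ifs <;> rfl

/-- The Lyapunov function of a small cell is at most `1 / 8`, and that of a large cell exceeds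
`1 / 8` only by the cost of the large scales up to its own. -/
lemma lyapunov_le (hr : 0 < r) (ht : 0 ≤ t) (hC : C ⊆ S) {j : ℕ} (hj : topScale d t ≤ j)
    (hCj : scale r C ≤ j) :
    lyapunov P B t C ≤ 1 / 8 + slope d t * (1 / 2 ^ topScale d t - 1 / 2 ^ j) := by
  have hA := slope_nonneg d ht
  have h0 : (0 : ℝ) ≤ slope d t * (1 / 2 ^ topScale d t - 1 / 2 ^ j) := by
    refine mul_nonneg hA (sub_nonneg.2 ?_)
    exact one_div_le_one_div_of_le (by positivity) (pow_le_pow_right₀ (by norm_num) hj)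
  have hM := one_le_cellBound d t
  unfold lyapunov
  split_ifs with h1 h2 h3
  · linarith
  · have : growth d ^ scale r C * P.h (scale r C) C / cellBound d t ≤ 1 / 8 := by
      rw [div_le_iff₀ (by linarith), cellBound]
      have e1 : growth d ^ scale r C ≤ growth d ^ topScale d t :=
        pow_le_pow_right₀ (one_le_growth d) h3
      have e2 := P.le_scale hr hC
      have e3 := P.nonneg (scale r C) C
      have e4 : 0 ≤ growth d ^ topScale d t := by have := one_le_growth d; positivity
      calc _ ≤ growth d ^ topScale d t * (2 ^ (d * netExponent d)) ^ 2 := by gcongr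
        _ = _ := by ring
    linarith
  · have e1 := P.log_le_logBound hr hC (Nat.pos_of_ne_zero h2)
    have e2 : slope d t / 2 ^ scale r C * ((1 + Real.log (P.h (scale r C) C)) / logBound d) ≤
        slope d t / 2 ^ scale r C := mul_le_of_le_one_right (by positivity) e1
    have e3 : slope d t * (1 / 2 ^ j) ≤ slope d t * (1 / 2 ^ scale r C) := by gcongr; norm_num
    have e4 : slope d t * (1 / 2 ^ topScale d t - 2 / 2 ^ scale r C) + slope d t / 2 ^ scale r C =
        slope d t * (1 / 2 ^ topScale d t) - slope d t * (1 / 2 ^ scale r C) := by ring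
    rw [mul_sub]
    linarith
  · linarith

lemma lyapunov_le_quarter (hr : 0 < r) (ht : 0 ≤ t) (hC : C ⊆ S) : lyapunov P B t C ≤ 1 / 4 := by
  have h := lyapunov_le P B hr ht hC (le_max_left (topScale d t) (scale r C)) (le_max_right _ _)
  have h1 := slope_div_two_pow_topScale_le d t
  have h2 : 0 ≤ slope d t * (1 / 2 ^ max (topScale d t) (scale r C)) := by
    have := slope_nonneg d ht
    positivity
  rw [mul_sub, ← div_eq_mul_one_div] at h
  linarith

lemma lyapunov_nonneg (hr : 0 < r) (ht : 0 ≤ t) (hC : C ⊆ S) : 0 ≤ lyapunov P B t C := by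
  have hA := slope_nonneg d ht
  have hM := one_le_cellBound d t
  have hQ := one_le_growth d
  have hΛ := logBound_pos d
  unfold lyapunov
  split_ifs with h1 h2 h3
  · exact le_rfl
  · have := P.nonneg (scale r C) C
    positivity
  · have e1 : 0 ≤ Real.log (P.h (scale r C) C) :=
      Real.log_nonneg (P.one_le_scale hr hC (Nat.pos_of_ne_zero h2))
    have e2 : (2 : ℝ) / 2 ^ scale r C ≤ 1 / 2 ^ topScale d t := by
      rw [div_le_div_iff₀ (by positivity) (by positivity), one_mul, ← pow_succ']
      exact pow_le_pow_right₀ (by norm_num) (by omega)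
    have e3 := sub_nonneg.2 e2
    positivity
  · exact le_rfl

/-- The drift of the Lyapunov function at a large cell. Within a scale, the function is the logarithm
of the potential, and `log x ≤ log y + x / y - 1` turns the contraction of the potential into a
decrease by a constant. That pays for the probability of cutting the ball. -/
lemma drift_large (hd : 0 < d) (hS : DoublingDimLE (S : Set (EuclideanSpace ℝ (Fin D))) d)
    (hr : 0 < r) {x : EuclideanSpace ℝ (Fin D)} {R : ℝ} (hR : 0 < R) (hC : C ⊆ S)
    {p : EuclideanSpace ℝ (Fin D)} (hp : p ∈ C) (hj : topScale d (R / r) < scale r C)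
    (hm : Meets C (Metric.closedBall x R)) :
    ∫ y, (lyapunov P (Metric.closedBall x R) (R / r)
            (child C y.1 (splitPoint C p y.1 y.2) true) +
        lyapunov P (Metric.closedBall x R) (R / r)
            (child C y.1 (splitPoint C p y.1 y.2) false) +
        nodeCost d r (Metric.closedBall x R) (R / r) C
          (child C y.1 (splitPoint C p y.1 y.2) true)
          (child C y.1 (splitPoint C p y.1 y.2) false)) ∂(nodeLaw D) ≤
      lyapunov P (Metric.closedBall x R) (R / r) C := by
  classical
  set B := Metric.closedBall x R with hB
  set t := R / r with htdef
  have ht : 0 < t := by positivity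
  have hA := slope_nonneg d ht.le
  have hΛ := logBound_pos d
  have hs0 : 0 < scale r C := by omega
  have hrad := lt_radius_of_scale hr hs0
  have hradp : 0 < radius C := lt_trans (by positivity) hrad
  have hh1 := P.one_le_scale hr hC hs0
  have hcontract := P.contract (scale r C) C hC p hp hrad (radius_le_of_scale hr C)
  set j := scale r C with hjdef
  have hlog := Real.log_nonneg hh1
  set base := 1 / 8 + slope d t * (1 / 2 ^ topScale d t - 2 / 2 ^ j) with hbase
  set K := slope d t / 2 ^ j / logBound d with hK
  have hK0 : 0 ≤ K := by positivity
  have hbase0 : 0 ≤ base := by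
    have e2 : (2 : ℝ) / 2 ^ j ≤ 1 / 2 ^ topScale d t := by
      rw [div_le_div_iff₀ (by positivity) (by positivity), one_mul, ← pow_succ']
      exact pow_le_pow_right₀ (by norm_num) (by omega)
    have e3 := sub_nonneg.2 e2
    positivity
  have hHC : lyapunov P B t C = base + K * (1 + Real.log (P.h j C)) := by
    rw [lyapunov, if_pos hm, if_neg (by omega), if_neg (by omega), ← hjdef, hK, hbase]
    ring
  have hchild : ∀ X ⊆ C, lyapunov P B t X ≤
      base + K * (Real.log (P.h j C) + P.h j X / P.h j C) := by
    intro X hX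
    have hX0 := P.nonneg j X
    have hlast : 0 ≤ K * (Real.log (P.h j C) + P.h j X / P.h j C) := by positivity
    by_cases hXm : Meets X B
    swap
    · rw [lyapunov_of_not_meets P B hXm]
      linarith
    rcases (scale_mono hr hX).lt_or_eq with hlt | heq
    · have h := lyapunov_le P B hr ht.le (hX.trans hC) (j := j - 1) (t := t) (by omega) (by omega)
      have e : (1 : ℝ) / 2 ^ (j - 1) = 2 / 2 ^ j := by
        obtain ⟨i, hi⟩ : ∃ i, j = i + 1 := ⟨j - 1, by omega⟩
        rw [hi, Nat.add_sub_cancel, pow_succ]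
        field_simp
      rw [e, ← hbase] at h
      linarith
    · rw [← hjdef] at heq
      have hX1 : 1 ≤ P.h j X := by
        rw [← heq]; exact P.one_le_scale hr (hX.trans hC) (by omega)
      have e1 : lyapunov P B t X = base + K * (1 + Real.log (P.h j X)) := by
        rw [lyapunov, if_pos hXm, if_neg (by omega), if_neg (by omega), heq, hK, hbase]
        ring
      have e2 := Real.log_le_sub_one_of_pos (x := P.h j X / P.h j C) (by positivity)
      rw [Real.log_div (by linarith) (by linarith)] at e2
      have e3 := mul_le_mul_of_nonneg_left (show 1 + Real.log (P.h j X) ≤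
        Real.log (P.h j C) + P.h j X / P.h j C by linarith) hK0
      linarith
  set A : Set (EuclideanSpace ℝ (Fin D) × ℝ) :=
    {y | Meets (child C y.1 (splitPoint C p y.1 y.2) true) B ∧
      Meets (child C y.1 (splitPoint C p y.1 y.2) false) B} with hAdef
  have mA : MeasurableSet A :=
    measurableSet_setOfPred.2 (measurable_children C p fun L L' => Meets L B ∧ Meets L' B)
  have hcut : (nodeLaw D).real A ≤ 128 * d * t / 2 ^ j := by
    refine (nodeLaw_cut_le hd hS hC hR hradp).trans ?_
    calc 64 * d * R / radius C ≤ 64 * d * R / (2 ^ j * r / 2) := by gcongr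
      _ = 128 * d * t / 2 ^ j := by rw [htdef]; field_simp; ring
  have hpt : ∀ y : EuclideanSpace ℝ (Fin D) × ℝ,
      lyapunov P B t (child C y.1 (splitPoint C p y.1 y.2) true) +
        lyapunov P B t (child C y.1 (splitPoint C p y.1 y.2) false) +
        nodeCost d r B t C (child C y.1 (splitPoint C p y.1 y.2) true)
          (child C y.1 (splitPoint C p y.1 y.2) false) ≤
      (base + K * Real.log (P.h j C)) + K / P.h j C *
        (P.h j (child C y.1 (splitPoint C p y.1 y.2) true) +
          P.h j (child C y.1 (splitPoint C p y.1 y.2) false)) + 2 * A.indicator 1 y := by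
    intro y
    have s1 := child_subset C y.1 (splitPoint C p y.1 y.2) true
    have s2 := child_subset C y.1 (splitPoint C p y.1 y.2) false
    set L := child C y.1 (splitPoint C p y.1 y.2) true with hL
    set L' := child C y.1 (splitPoint C p y.1 y.2) false with hL'
    have n1 := P.nonneg j L
    have n2 := P.nonneg j L'
    have nK1 : 0 ≤ K / P.h j C * P.h j L := by positivity
    have nK2 : 0 ≤ K / P.h j C * P.h j L' := by positivity
    have nK : 0 ≤ K * Real.log (P.h j C) := by positivity
    have c1 := hchild L s1
    have c2 := hchild L' s2
    have q1 := lyapunov_le_quarter P B hr ht.le (s1.trans hC)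
    have q2 := lyapunov_le_quarter P B hr ht.le (s2.trans hC)
    have d1 : K * (Real.log (P.h j C) + P.h j L / P.h j C) =
      K * Real.log (P.h j C) + K / P.h j C * P.h j L := by ring
    have d2 : K * (Real.log (P.h j C) + P.h j L' / P.h j C) =
      K * Real.log (P.h j C) + K / P.h j C * P.h j L' := by ring
    rw [d1] at c1
    rw [d2] at c2
    rw [nodeCost, if_pos hj, mul_add]
    by_cases hy : Meets L B ∧ Meets L' B
    · have hyA : y ∈ A := hy
      rw [if_pos hy, Set.indicator_of_mem hyA, Pi.one_apply]
      linarith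
    · have hyA : y ∉ A := hy
      rw [if_neg hy, Set.indicator_of_notMem hyA]
      by_cases h1 : Meets L B
      · have h2 : ¬ Meets L' B := fun h2 => hy ⟨h1, h2⟩
        rw [lyapunov_of_not_meets P B h2]
        linarith
      · rw [lyapunov_of_not_meets P B h1]
        linarith
  have iA : Integrable (A.indicator (1 : EuclideanSpace ℝ (Fin D) × ℝ → ℝ)) (nodeLaw D) :=
    (integrable_const 1).indicator mA
  have ih := (integrable_children C p fun L L' => P.h j L + P.h j L').const_mul (K / P.h j C)
  have ih' : Integrable (fun y : EuclideanSpace ℝ (Fin D) × ℝ =>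
      (base + K * Real.log (P.h j C)) + K / P.h j C *
        (P.h j (child C y.1 (splitPoint C p y.1 y.2) true) +
          P.h j (child C y.1 (splitPoint C p y.1 y.2) false))) (nodeLaw D) :=
    (integrable_const _).add ih
  have hfinal : K / P.h j C * ((1 - 1 / 10 ^ 4) * P.h j C) = K * (1 - 1 / 10 ^ 4) := by
    field_simp
  have hpay : 2 * (128 * d * t / 2 ^ j) = K * (1 / 10 ^ 4) := by
    rw [hK, slope]; field_simp; ring
  calc _ ≤ ∫ y, ((base + K * Real.log (P.h j C)) + K / P.h j C *
        (P.h j (child C y.1 (splitPoint C p y.1 y.2) true) +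
          P.h j (child C y.1 (splitPoint C p y.1 y.2) false)) + 2 * A.indicator 1 y)
          ∂(nodeLaw D) :=
        integral_mono (integrable_children C p fun L L' => lyapunov P B t L + lyapunov P B t L' +
          nodeCost d r B t C L L') (ih'.add (iA.const_mul 2)) hpt
    _ = (base + K * Real.log (P.h j C)) + K / P.h j C *
        ∫ y, (P.h j (child C y.1 (splitPoint C p y.1 y.2) true) +
          P.h j (child C y.1 (splitPoint C p y.1 y.2) false)) ∂(nodeLaw D) +
        2 * (nodeLaw D).real A := by
        rw [integral_add ih' (iA.const_mul 2),
          integral_add (integrable_const _) ih, integral_const_mul, integral_const_mul,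
          integral_indicator_one mA, integral_const, probReal_univ, one_smul]
    _ ≤ (base + K * Real.log (P.h j C)) + K / P.h j C * ((1 - 1 / 10 ^ 4) * P.h j C) +
        2 * (128 * d * t / 2 ^ j) := by gcongr
    _ = lyapunov P B t C := by rw [hfinal, hpay, hHC]; ring

/-- The drift of the Lyapunov function at a small cell: the contraction of the potential at the scale
of the cell pays for the cell itself and for both children, should they be of a lower scale. -/
lemma drift_small (hr : 0 < r) (hC : C ⊆ S) {p : EuclideanSpace ℝ (Fin D)} (hp : p ∈ C)
    (hj0 : 0 < scale r C) (hj : scale r C ≤ topScale d t) (hm : Meets C B) :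
    ∫ y, (lyapunov P B t (child C y.1 (splitPoint C p y.1 y.2) true) +
        lyapunov P B t (child C y.1 (splitPoint C p y.1 y.2) false) +
        nodeCost d r B t C (child C y.1 (splitPoint C p y.1 y.2) true)
          (child C y.1 (splitPoint C p y.1 y.2) false)) ∂(nodeLaw D) ≤
      lyapunov P B t C := by
  have hh1 := P.one_le_scale hr hC hj0
  have hcontract := P.contract (scale r C) C hC p hp (lt_radius_of_scale hr hj0)
    (radius_le_of_scale hr C)
  set j := scale r C with hjdef
  obtain ⟨i, hi⟩ : ∃ i, j = i + 1 := ⟨j - 1, by omega⟩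
  have hM : 0 < cellBound d t := by have := one_le_cellBound d t; linarith
  have hQ := one_le_growth d
  set N2 : ℝ := (2 ^ (d * netExponent d)) ^ 2 with hN2
  have hN1 : 1 ≤ N2 := one_le_pow₀ (one_le_pow₀ (by norm_num))
  have hHC : lyapunov P B t C = growth d ^ j * P.h j C / cellBound d t := by
    rw [lyapunov, if_pos hm, if_neg (by omega), if_pos (by omega)]
  have hchild : ∀ X ⊆ C, lyapunov P B t X ≤
      growth d ^ j / cellBound d t * P.h j X + growth d ^ i * N2 / cellBound d t := by
    intro X hX
    have hX0 := P.nonneg j X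
    have e1 : 0 ≤ growth d ^ j / cellBound d t * P.h j X := by positivity
    have e2 : 0 ≤ growth d ^ i * N2 / cellBound d t := by positivity
    have hsc := scale_mono hr hX
    rw [lyapunov]
    split_ifs with h1 h2 h3
    · linarith
    · rcases hsc.lt_or_eq with hlt | heq
      · have e3 : growth d ^ scale r X ≤ growth d ^ i := pow_le_pow_right₀ hQ (by omega)
        have e4 := P.le_scale hr (hX.trans hC)
        have e5 := P.nonneg (scale r X) X
        have e6 : growth d ^ scale r X * P.h (scale r X) X / cellBound d t ≤
          growth d ^ i * N2 / cellBound d t := by gcongr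
        linarith
      · rw [heq, ← hjdef, mul_div_right_comm]
        linarith
    · omega
    · linarith
  have hpt : ∀ y : EuclideanSpace ℝ (Fin D) × ℝ,
      lyapunov P B t (child C y.1 (splitPoint C p y.1 y.2) true) +
        lyapunov P B t (child C y.1 (splitPoint C p y.1 y.2) false) +
        nodeCost d r B t C (child C y.1 (splitPoint C p y.1 y.2) true)
          (child C y.1 (splitPoint C p y.1 y.2) false) ≤
      growth d ^ j / cellBound d t *
        (P.h j (child C y.1 (splitPoint C p y.1 y.2) true) +
          P.h j (child C y.1 (splitPoint C p y.1 y.2) false)) +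
        (2 * (growth d ^ i * N2 / cellBound d t) + 1 / cellBound d t) := by
    intro y
    have c1 := hchild _ (child_subset C y.1 (splitPoint C p y.1 y.2) true)
    have c2 := hchild _ (child_subset C y.1 (splitPoint C p y.1 y.2) false)
    rw [nodeCost, if_neg (by omega), if_pos ⟨by omega, hm⟩]
    linarith
  have ih := (integrable_children C p fun L L' => P.h j L + P.h j L').const_mul
    (growth d ^ j / cellBound d t)
  have hpay : 2 * (growth d ^ i * N2) + 1 ≤ growth d ^ j * P.h j C * (1 / 10 ^ 4) := by
    have e1 : growth d ^ j * (1 / 10 ^ 4) = growth d ^ i * (3 * N2) := by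
      rw [hi, pow_succ]
      nth_rewrite 2 [growth]
      rw [← hN2]
      ring
    have e2 : 1 ≤ growth d ^ i := one_le_pow₀ hQ
    have e3 : 1 ≤ growth d ^ i * N2 := one_le_mul_of_one_le_of_one_le e2 hN1
    calc 2 * (growth d ^ i * N2) + 1 ≤ growth d ^ i * (3 * N2) * 1 := by linarith
      _ ≤ growth d ^ i * (3 * N2) * P.h j C := by gcongr
      _ = _ := by rw [← e1]; ring
  calc _ ≤ ∫ y, (growth d ^ j / cellBound d t *
        (P.h j (child C y.1 (splitPoint C p y.1 y.2) true) +
          P.h j (child C y.1 (splitPoint C p y.1 y.2) false)) +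
        (2 * (growth d ^ i * N2 / cellBound d t) + 1 / cellBound d t)) ∂(nodeLaw D) :=
        integral_mono (integrable_children C p fun L L' => lyapunov P B t L + lyapunov P B t L' +
          nodeCost d r B t C L L') (ih.add (integrable_const _)) hpt
    _ = growth d ^ j / cellBound d t *
        ∫ y, (P.h j (child C y.1 (splitPoint C p y.1 y.2) true) +
          P.h j (child C y.1 (splitPoint C p y.1 y.2) false)) ∂(nodeLaw D) +
        (2 * (growth d ^ i * N2 / cellBound d t) + 1 / cellBound d t) := by
        rw [integral_add ih (integrable_const _), integral_const_mul, integral_const,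
          probReal_univ, one_smul]
    _ ≤ growth d ^ j / cellBound d t * ((1 - 1 / 10 ^ 4) * P.h j C) +
        (2 * (growth d ^ i * N2 / cellBound d t) + 1 / cellBound d t) := by
        gcongr
    _ = (growth d ^ j * P.h j C - growth d ^ j * P.h j C * (1 / 10 ^ 4) +
          (2 * (growth d ^ i * N2) + 1)) / cellBound d t := by ring
    _ ≤ lyapunov P B t C := by
        rw [hHC]
        gcongr
        linarith

/-- The Lyapunov function of a cell is at least the expected cost of the node plus the expected sum
of the function over the children. -/
theorem drift (hd : 0 < d) (hS : DoublingDimLE (S : Set (EuclideanSpace ℝ (Fin D))) d)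
    (hr : 0 < r) {x : EuclideanSpace ℝ (Fin D)} {R : ℝ} (hR : 0 < R) (hC : C ⊆ S)
    {p : EuclideanSpace ℝ (Fin D)} (hp : C.Nonempty → p ∈ C) :
    ∫ y, (lyapunov P (Metric.closedBall x R) (R / r)
            (child C y.1 (splitPoint C p y.1 y.2) true) +
        lyapunov P (Metric.closedBall x R) (R / r)
            (child C y.1 (splitPoint C p y.1 y.2) false) +
        nodeCost d r (Metric.closedBall x R) (R / r) C
          (child C y.1 (splitPoint C p y.1 y.2) true)
          (child C y.1 (splitPoint C p y.1 y.2) false)) ∂(nodeLaw D) ≤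
      lyapunov P (Metric.closedBall x R) (R / r) C := by
  have hsub := fun (y : EuclideanSpace ℝ (Fin D) × ℝ) b =>
    child_subset C y.1 (splitPoint C p y.1 y.2) b
  by_cases hm : Meets C (Metric.closedBall x R)
  · have hpC : p ∈ C := hp (let ⟨z, hz, _⟩ := hm; ⟨z, hz⟩)
    rcases Nat.eq_zero_or_pos (scale r C) with h0 | h0
    · have hL : ∀ y : EuclideanSpace ℝ (Fin D) × ℝ, ∀ b, lyapunov P (Metric.closedBall x R) (R / r)
          (child C y.1 (splitPoint C p y.1 y.2) b) = 0 := fun y b =>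
        lyapunov_of_scale_eq_zero P _ (Nat.le_zero.1 (h0 ▸ scale_mono hr (hsub y b)))
      rw [lyapunov_of_scale_eq_zero P _ h0]
      simp [hL, nodeCost, h0]
    · rcases lt_or_ge (topScale d (R / r)) (scale r C) with hj | hj
      · exact drift_large P hd hS hr hR hC hpC hj hm
      · exact drift_small P _ hr hC hpC h0 hj hm
  · have hL : ∀ y : EuclideanSpace ℝ (Fin D) × ℝ, ∀ b,
        ¬ Meets (child C y.1 (splitPoint C p y.1 y.2) b) (Metric.closedBall x R) :=
      fun y b h => hm (h.mono (hsub y b))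
    rw [lyapunov_of_not_meets P _ hm]
    simp [lyapunov_of_not_meets, hL, nodeCost, hm]

end Drift

/-! ### The random tree -/

section Tree

variable {D : ℕ} (S : Finset (EuclideanSpace ℝ (Fin D)))
  (pivot : List Bool → Finset (EuclideanSpace ℝ (Fin D)) → EuclideanSpace ℝ (Fin D))

lemma cell_subset_of_suffix (ω : Choices D) {u w : List Bool} (h : u <:+ w) :
    cell S pivot ω w ⊆ cell S pivot ω u := by
  obtain ⟨l, rfl⟩ := h
  induction l with
  | nil => exact Finset.Subset.refl _
  | cons b l ih => exact (child_subset _ _ _ _).trans ih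

lemma cell_subset (ω : Choices D) (w : List Bool) : cell S pivot ω w ⊆ S :=
  cell_subset_of_suffix S pivot ω (List.nil_suffix)

/-- A cell depends on the choices at its proper ancestors only. -/
lemma cell_congr {ω ω' : Choices D} {w : List Bool}
    (h : ∀ u, u <:+ w → u ≠ w → ω u = ω' u) : cell S pivot ω w = cell S pivot ω' w := by
  induction w with
  | nil => rfl
  | cons b w ih =>
    have h1 : cell S pivot ω w = cell S pivot ω' w := ih fun u hu _ =>
      h u (hu.trans (List.suffix_cons b w)) fun he => by
        have := hu.length_le
        rw [he, List.length_cons] at this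
        omega
    have h2 : ω w = ω' w := h w (List.suffix_cons b w) (List.cons_ne_self b w).symm
    rw [cell, cell, h1, h2]

lemma measurable_cell (w : List Bool) : Measurable fun ω : Choices D => cell S pivot ω w := by
  induction w with
  | nil => exact measurable_const
  | cons b w ih =>
    intro s _
    have : (fun ω : Choices D => cell S pivot ω (b :: w)) ⁻¹' s =
        ⋃ C ∈ S.powerset, ((fun ω => cell S pivot ω w) ⁻¹' {C}) ∩
          (fun ω : Choices D => child C (ω w).1 (splitPoint C (pivot w C) (ω w).1 (ω w).2) b) ⁻¹'
            s := by
      ext ω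
      simp only [Set.mem_preimage, Set.mem_iUnion, Set.mem_inter_iff, Set.mem_singleton_iff,
        exists_prop, cell]
      constructor
      · exact fun h => ⟨_, Finset.mem_powerset.2 (cell_subset S pivot ω w), rfl, h⟩
      · rintro ⟨C, -, rfl, h⟩
        exact h
    rw [this]
    refine Finset.measurableSet_biUnion _ fun C _ => MeasurableSet.inter (ih trivial) ?_
    exact ((measurable_child C (pivot w C) b).comp (measurable_pi_apply w)) trivial

/-- The cell at a node is independent of the choices at that node. -/
lemma indepFun_cell (w : List Bool) :
    IndepFun (fun ω : Choices D => cell S pivot ω w) (fun ω => ω w) (choicesLaw D) := by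
  classical
  have hi : iIndepFun (fun (u : List Bool) (ω : Choices D) => ω u) (choicesLaw D) :=
    iIndepFun_infinitePi (X := fun _ y => y) fun _ => measurable_id
  let I : Finset (List Bool) := (w.tails.toFinset).erase w
  have hdisj : Disjoint I {w} := by simp [I]
  have h := hi.indepFun_finset I {w} hdisj fun u => measurable_pi_apply u
  let extend : (I → EuclideanSpace ℝ (Fin D) × ℝ) → Choices D :=
    fun q u => if hu : u ∈ I then q ⟨u, hu⟩ else 0
  have hext : Measurable extend := by
    refine measurable_pi_iff.2 fun u => ?_
    by_cases hu : u ∈ I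
    · simp only [extend, dif_pos hu]
      exact measurable_pi_apply _
    · simp only [extend, dif_neg hu]
      exact measurable_const
  have h' := h.comp ((measurable_cell S pivot w).comp hext)
    (measurable_pi_apply (⟨w, Finset.mem_singleton_self w⟩ : ({w} : Finset (List Bool))))
  have hcell : (fun ω : Choices D => cell S pivot ω w) =
      ((fun ω => cell S pivot ω w) ∘ extend) ∘ fun ω (u : I) => ω u := by
    funext ω
    refine cell_congr S pivot fun u hu hne => ?_
    have huI : u ∈ I := by simp [I, hu, hne]
    simp [extend, huI]
  rw [hcell]
  exact h'

lemma lintegral_cell_choice (w : List Bool)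
    (f : Finset (EuclideanSpace ℝ (Fin D)) → EuclideanSpace ℝ (Fin D) × ℝ → ℝ≥0∞)
    (hf : ∀ C, Measurable (f C)) :
    ∫⁻ ω, f (cell S pivot ω w) (ω w) ∂(choicesLaw D) =
      ∫⁻ ω, ∫⁻ y, f (cell S pivot ω w) y ∂(nodeLaw D) ∂(choicesLaw D) := by
  classical
  let ind : Finset (EuclideanSpace ℝ (Fin D)) → Finset (EuclideanSpace ℝ (Fin D)) → ℝ≥0∞ :=
    fun C C' => if C' = C then 1 else 0
  have hind : ∀ C, Measurable (fun ω : Choices D => ind C (cell S pivot ω w)) := fun C =>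
    (Measurable.of_discrete (f := ind C)).comp (measurable_cell S pivot w)
  have hfw : ∀ C, Measurable (fun ω : Choices D => f C (ω w)) := fun C =>
    (hf C).comp (measurable_pi_apply w)
  have hsum : ∀ (ω : Choices D) (g : Finset (EuclideanSpace ℝ (Fin D)) → ℝ≥0∞),
      g (cell S pivot ω w) = ∑ C ∈ S.powerset, ind C (cell S pivot ω w) * g C := by
    intro ω g
    rw [Finset.sum_eq_single_of_mem (cell S pivot ω w)
      (Finset.mem_powerset.2 (cell_subset S pivot ω w))]
    · simp [ind]
    · intro C _ hne
      simp [ind, hne.symm]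
  have hlaw : ∀ C, ∫⁻ ω, f C (ω w) ∂(choicesLaw D) = ∫⁻ y, f C y ∂(nodeLaw D) := by
    intro C
    exact (measurePreserving_eval_infinitePi (fun _ : List Bool => nodeLaw D) w).lintegral_comp
      (hf C)
  calc ∫⁻ ω, f (cell S pivot ω w) (ω w) ∂(choicesLaw D)
      = ∫⁻ ω, ∑ C ∈ S.powerset, ind C (cell S pivot ω w) * f C (ω w) ∂(choicesLaw D) :=
        lintegral_congr fun ω => hsum ω fun C => f C (ω w)
    _ = ∑ C ∈ S.powerset, ∫⁻ ω, ind C (cell S pivot ω w) * f C (ω w) ∂(choicesLaw D) :=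
        lintegral_finsetSum _ fun C _ => (hind C).mul (hfw C)
    _ = ∑ C ∈ S.powerset, (∫⁻ ω, ind C (cell S pivot ω w) ∂(choicesLaw D)) *
          ∫⁻ y, f C y ∂(nodeLaw D) := by
        refine Finset.sum_congr rfl fun C _ => ?_
        rw [← hlaw C]
        exact lintegral_mul_eq_lintegral_mul_lintegral_of_indepFun (hind C) (hfw C)
          ((indepFun_cell S pivot w).comp (Measurable.of_discrete (f := ind C)) (hf C))
    _ = ∑ C ∈ S.powerset, ∫⁻ ω, ind C (cell S pivot ω w) * ∫⁻ y, f C y ∂(nodeLaw D)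
          ∂(choicesLaw D) :=
        Finset.sum_congr rfl fun C _ => (lintegral_mul_const _ (hind C)).symm
    _ = ∫⁻ ω, ∑ C ∈ S.powerset, ind C (cell S pivot ω w) * ∫⁻ y, f C y ∂(nodeLaw D)
          ∂(choicesLaw D) :=
        (lintegral_finsetSum _ fun C _ => (hind C).mul_const _).symm
    _ = _ := lintegral_congr fun ω => (hsum ω fun C => ∫⁻ y, f C y ∂(nodeLaw D)).symm

end Tree

/-- The nodes at depth `n`. -/
def nodesAt : ℕ → Finset (List Bool)
  | 0 => {[]}
  | n + 1 => (nodesAt n ×ˢ Finset.univ).map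
      ⟨fun q : List Bool × Bool => q.2 :: q.1, fun _ _ h => by
        rw [List.cons.injEq] at h
        exact Prod.ext h.2 h.1⟩

lemma mem_nodesAt_length (w : List Bool) : w ∈ nodesAt w.length := by
  induction w with
  | nil => simp [nodesAt]
  | cons b w ih =>
    rw [List.length_cons, nodesAt, Finset.mem_map]
    exact ⟨(w, b), Finset.mem_product.2 ⟨ih, Finset.mem_univ _⟩, rfl⟩

lemma sum_nodesAt_succ (n : ℕ) (f : List Bool → ℝ≥0∞) :
    ∑ w ∈ nodesAt (n + 1), f w = ∑ w ∈ nodesAt n, (f (true :: w) + f (false :: w)) := by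
  rw [nodesAt, Finset.sum_map, Finset.sum_product]
  simp only [Fintype.sum_bool]
  rfl

/-- If `a` bounds, at every node of the binary tree, the cost `c` of the node plus the values of `a` at
the two children, then the total cost is at most the value of `a` at the root. -/
lemma tsum_le_of_drift {a c : List Bool → ℝ≥0∞}
    (h : ∀ w, a (true :: w) + a (false :: w) + c w ≤ a w) : ∑' w, c w ≤ a [] := by
  classical
  have hlevel : ∀ n, ∑ w ∈ nodesAt n, a w + ∑ k ∈ Finset.range n, ∑ w ∈ nodesAt k, c w ≤ a [] := by
    intro n
    induction n with
    | zero => simp [nodesAt]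
    | succ n ih =>
      rw [Finset.sum_range_succ, sum_nodesAt_succ]
      calc _ = ∑ w ∈ nodesAt n, (a (true :: w) + a (false :: w) + c w) +
            ∑ k ∈ Finset.range n, ∑ w ∈ nodesAt k, c w := by
            rw [Finset.sum_add_distrib (f := fun w => a (true :: w) + a (false :: w))]
            ring
        _ ≤ _ := by
            refine le_trans ?_ ih
            gcongr with w _
            exact h w
  rw [ENNReal.tsum_eq_iSup_sum]
  refine iSup_le fun F => ?_
  let n := F.sup List.length + 1
  have hF : ∀ w ∈ F, w.length ∈ Finset.range n := fun w hw =>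
    Finset.mem_range.2 (Nat.lt_succ_of_le (Finset.le_sup (f := List.length) hw))
  calc ∑ w ∈ F, c w = ∑ k ∈ Finset.range n, ∑ w ∈ F with w.length = k, c w :=
        (Finset.sum_fiberwise_of_maps_to hF c).symm
    _ ≤ ∑ k ∈ Finset.range n, ∑ w ∈ nodesAt k, c w := by
        refine Finset.sum_le_sum fun k _ => Finset.sum_le_sum_of_subset fun w hw => ?_
        rw [← (Finset.mem_filter.1 hw).2]
        exact mem_nodesAt_length w
    _ ≤ a [] := le_trans le_add_self (hlevel n)

/-- Two nodes are comparable, or their paths part at some node `u`. -/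
lemma suffix_or_branch (w₀ w₁ : List Bool) :
    w₀ <:+ w₁ ∨ w₁ <:+ w₀ ∨ ∃ u b, (b :: u) <:+ w₀ ∧ ((!b) :: u) <:+ w₁ := by
  have key : ∀ l₀ l₁ : List Bool, l₀ <+: l₁ ∨ l₁ <+: l₀ ∨
      ∃ u b, (u ++ [b]) <+: l₀ ∧ (u ++ [!b]) <+: l₁ := by
    intro l₀
    induction l₀ with
    | nil => exact fun l₁ => Or.inl List.nil_prefix
    | cons b l₀ ih =>
      rintro (_ | ⟨b', l₁⟩)
      · exact Or.inr (Or.inl List.nil_prefix)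
      · by_cases hb : b' = b
        · subst hb
          rcases ih l₁ with h | h | ⟨u, e, h0, h1⟩
          · exact Or.inl ((List.prefix_cons_inj _).2 h)
          · exact Or.inr (Or.inl ((List.prefix_cons_inj _).2 h))
          · exact Or.inr (Or.inr ⟨b' :: u, e, (List.prefix_cons_inj _).2 h0,
              (List.prefix_cons_inj _).2 h1⟩)
        · obtain rfl : b' = !b := by cases b <;> cases b' <;> simp_all
          exact Or.inr (Or.inr ⟨[], b, by simp, by simp⟩)
  rcases key w₀.reverse w₁.reverse with h | h | ⟨u, b, h0, h1⟩
  · exact Or.inl (List.reverse_prefix.1 h)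
  · exact Or.inr (Or.inl (List.reverse_prefix.1 h))
  · refine Or.inr (Or.inr ⟨u.reverse, b, ?_, ?_⟩)
    · rw [← List.reverse_prefix]; simpa using h0
    · rw [← List.reverse_prefix]; simpa using h1

section Cost

variable {D : ℕ} (S : Finset (EuclideanSpace ℝ (Fin D)))
  (pivot : List Bool → Finset (EuclideanSpace ℝ (Fin D)) → EuclideanSpace ℝ (Fin D))
  (d : ℕ) (r : ℝ) (B : Set (EuclideanSpace ℝ (Fin D))) (t : ℝ)

/-- The cost of the node `w` of the random tree. -/
noncomputable def treeCost (ω : Choices D) (w : List Bool) : ℝ≥0∞ :=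
  ENNReal.ofReal (nodeCost d r B t (cell S pivot ω w) (cell S pivot ω (true :: w))
    (cell S pivot ω (false :: w)))

lemma nodeCost_nonneg (C L L' : Finset (EuclideanSpace ℝ (Fin D))) :
    0 ≤ nodeCost d r B t C L L' := by
  have := one_le_cellBound d t
  unfold nodeCost
  split_ifs <;> positivity

/-- If the total cost is less than `1`, then there are at most `cellBound` disjoint cells. Small
cells are counted by their costs. If one of the cells is large, then it is the only one: the paths
to two disjoint cells part at a common ancestor, which is large as well, and whose split cuts the
ball, at cost `1`. -/
lemma card_le_cellBound {d : ℕ} {r : ℝ} {B : Set (EuclideanSpace ℝ (Fin D))} {t : ℝ} (hr : 0 < r)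
    {ω : Choices D} (hω : ∑' w, treeCost S pivot d r B t ω w < 1) {F : Finset (List Bool)}
    (hF : ∀ w ∈ F, r < radius (cell S pivot ω w) ∧ Meets (cell S pivot ω w) B)
    (hdisj : (F : Set (List Bool)).PairwiseDisjoint (cell S pivot ω)) :
    (F.card : ℝ) ≤ cellBound d t := by
  have hM := one_le_cellBound d t
  by_cases hlarge : ∃ w₀ ∈ F, topScale d t < scale r (cell S pivot ω w₀)
  · obtain ⟨w₀, hw₀, htop⟩ := hlarge
    have hone : ∀ w₁ ∈ F, w₁ = w₀ := by
      intro w₁ hw₁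
      by_contra hne
      have hd : Disjoint (cell S pivot ω w₁) (cell S pivot ω w₀) := hdisj hw₁ hw₀ hne
      have hne₀ := nonempty_of_radius_pos (hr.trans (hF w₀ hw₀).1)
      have hne₁ := nonempty_of_radius_pos (hr.trans (hF w₁ hw₁).1)
      rcases suffix_or_branch w₀ w₁ with h | h | ⟨u, b, h0, h1⟩
      · have := hd.eq_bot_of_le (cell_subset_of_suffix S pivot ω h)
        simp [this] at hne₁
      · have := hd.symm.eq_bot_of_le (cell_subset_of_suffix S pivot ω h)
        simp [this] at hne₀
      · have m0 := (hF w₀ hw₀).2.mono (cell_subset_of_suffix S pivot ω h0)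
        have m1 := (hF w₁ hw₁).2.mono (cell_subset_of_suffix S pivot ω h1)
        have hu : topScale d t < scale r (cell S pivot ω u) :=
          htop.trans_le (scale_mono hr
            (cell_subset_of_suffix S pivot ω ((List.suffix_cons b u).trans h0)))
        have hboth : Meets (cell S pivot ω (true :: u)) B ∧
            Meets (cell S pivot ω (false :: u)) B := by
          cases b
          · exact ⟨m1, m0⟩
          · exact ⟨m0, m1⟩
        have hcost : treeCost S pivot d r B t ω u = 1 := by
          rw [treeCost, nodeCost, if_pos hu, if_pos hboth, ENNReal.ofReal_one]
        exact absurd (ENNReal.le_tsum u) (not_le.2 (hcost ▸ hω))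
    have : F.card ≤ 1 := Finset.card_le_one.2 fun a ha b hb => (hone a ha).trans (hone b hb).symm
    have : (F.card : ℝ) ≤ 1 := by exact_mod_cast this
    linarith
  · push Not at hlarge
    have hcost : ∀ w ∈ F, treeCost S pivot d r B t ω w = ENNReal.ofReal (1 / cellBound d t) := by
      intro w hw
      rw [treeCost, nodeCost, if_neg (hlarge w hw).not_gt,
        if_pos ⟨(scale_pos_iff hr).2 (hF w hw).1, (hF w hw).2⟩]
    have h := (ENNReal.sum_le_tsum F).trans_lt hω
    rw [Finset.sum_congr rfl hcost, Finset.sum_const, nsmul_eq_mul, ← ENNReal.ofReal_natCast,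
      ← ENNReal.ofReal_mul (by positivity), ← ENNReal.ofReal_one,
      ENNReal.ofReal_lt_ofReal_iff one_pos, mul_one_div, div_lt_one (by linarith)] at h
    exact h.le

lemma measurable_treeCost (w : List Bool) :
    Measurable fun ω : Choices D => treeCost S pivot d r B t ω w := by
  have h : ∀ b, Measurable fun ω : Choices D => cell S pivot ω (b :: w) := fun b =>
    measurable_cell S pivot (b :: w)
  have hw := measurable_cell S pivot w
  refine ENNReal.measurable_ofReal.comp ?_
  unfold nodeCost
  have hm : ∀ b, MeasurableSet {ω : Choices D | Meets (cell S pivot ω (b :: w)) B} := fun b =>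
    (h b) (t := {C | Meets C B}) trivial
  refine Measurable.ite ?_ (Measurable.ite ((hm true).inter (hm false)) measurable_const
    measurable_const) (Measurable.ite ?_ measurable_const measurable_const)
  · exact hw (t := {C | topScale d t < scale r C}) trivial
  · exact hw (t := {C | 0 < scale r C ∧ Meets C B}) trivial

/-- The expected total cost of the random tree is at most the Lyapunov function of its root. -/
lemma lintegral_tsum_treeCost_le {d : ℕ} {r : ℝ} (hd : 0 < d)
    (hS : DoublingDimLE (S : Set (EuclideanSpace ℝ (Fin D))) d)
    (hpivot : ∀ (w : List Bool) (C : Finset (EuclideanSpace ℝ (Fin D))),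
      C.Nonempty → pivot w C ∈ C)
    (P : ScalePotential S d r) (hr : 0 < r) (x : EuclideanSpace ℝ (Fin D)) {R : ℝ} (hR : 0 < R) :
    ∫⁻ ω, ∑' w, treeCost S pivot d r (Metric.closedBall x R) (R / r) ω w ∂(choicesLaw D) ≤
      ENNReal.ofReal (lyapunov P (Metric.closedBall x R) (R / r) S) := by
  set B := Metric.closedBall x R with hB
  set t := R / r with htdef
  have ht : 0 ≤ t := by positivity
  have hH : Measurable fun C => ENNReal.ofReal (lyapunov P B t C) := Measurable.of_discrete
  rw [lintegral_tsum fun w => (measurable_treeCost S pivot d r B t w).aemeasurable]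
  let a : List Bool → ℝ≥0∞ := fun w =>
    ∫⁻ ω, ENNReal.ofReal (lyapunov P B t (cell S pivot ω w)) ∂(choicesLaw D)
  have ha : a [] = ENNReal.ofReal (lyapunov P B t S) := by
    have : IsProbabilityMeasure (choicesLaw D) := by unfold choicesLaw; infer_instance
    simp [a, cell]
  rw [← ha]
  refine tsum_le_of_drift fun w => ?_
  have hmH : ∀ w, Measurable fun ω : Choices D =>
      ENNReal.ofReal (lyapunov P B t (cell S pivot ω w)) := fun w =>
    hH.comp (measurable_cell S pivot w)
  let f : Finset (EuclideanSpace ℝ (Fin D)) → EuclideanSpace ℝ (Fin D) × ℝ → ℝ := fun C y =>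
    lyapunov P B t (child C y.1 (splitPoint C (pivot w C) y.1 y.2) true) +
      lyapunov P B t (child C y.1 (splitPoint C (pivot w C) y.1 y.2) false) +
      nodeCost d r B t C (child C y.1 (splitPoint C (pivot w C) y.1 y.2) true)
        (child C y.1 (splitPoint C (pivot w C) y.1 y.2) false)
  have hf : ∀ C, Measurable fun y => ENNReal.ofReal (f C y) := fun C =>
    measurable_children C (pivot w C) fun L L' => ENNReal.ofReal
      (lyapunov P B t L + lyapunov P B t L' + nodeCost d r B t C L L')
  calc a (true :: w) + a (false :: w) +
        ∫⁻ ω, treeCost S pivot d r B t ω w ∂(choicesLaw D)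
      = ∫⁻ ω, ENNReal.ofReal (f (cell S pivot ω w) (ω w)) ∂(choicesLaw D) := by
        have hm2 : Measurable fun ω : Choices D =>
            ENNReal.ofReal (lyapunov P B t (cell S pivot ω (true :: w))) +
              ENNReal.ofReal (lyapunov P B t (cell S pivot ω (false :: w))) :=
          (hmH _).add (hmH _)
        rw [← lintegral_add_left (hmH _), ← lintegral_add_left hm2]
        refine lintegral_congr fun ω => ?_
        have n1 := lyapunov_nonneg P B hr ht (cell_subset S pivot ω (true :: w))
        have n2 := lyapunov_nonneg P B hr ht (cell_subset S pivot ω (false :: w))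
        rw [treeCost, ← ENNReal.ofReal_add n1 n2,
          ← ENNReal.ofReal_add (add_nonneg n1 n2) (nodeCost_nonneg ..)]
        rfl
    _ = ∫⁻ ω, ∫⁻ y, ENNReal.ofReal (f (cell S pivot ω w) y) ∂(nodeLaw D) ∂(choicesLaw D) :=
        lintegral_cell_choice S pivot w (fun C y => ENNReal.ofReal (f C y)) hf
    _ ≤ a w := by
        refine lintegral_mono fun ω => ?_
        have hC := cell_subset S pivot ω w
        have hnn : ∀ y, 0 ≤ f (cell S pivot ω w) y := fun y =>
          add_nonneg (add_nonneg
            (lyapunov_nonneg P B hr ht ((child_subset _ _ _ _).trans hC))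
            (lyapunov_nonneg P B hr ht ((child_subset _ _ _ _).trans hC))) (nodeCost_nonneg ..)
        have hint : Integrable (f (cell S pivot ω w)) (nodeLaw D) :=
          integrable_children _ (pivot w (cell S pivot ω w)) fun L L' =>
            lyapunov P B t L + lyapunov P B t L' + nodeCost d r B t (cell S pivot ω w) L L'
        rw [← ofReal_integral_eq_lintegral_ofReal hint (Filter.Eventually.of_forall hnn)]
        exact ENNReal.ofReal_le_ofReal
          (drift P hd hS hr hR hC (p := pivot w (cell S pivot ω w)) (hpivot w _))

end Cost

/-! ### The size of the bound -/

lemma two_pow_clog_le {n : ℕ} (hn : 1 ≤ n) : 2 ^ Nat.clog 2 n ≤ 2 * n := by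
  rcases hn.eq_or_lt with rfl | h
  · simp
  · have h1 := Nat.pow_pred_clog_lt_self (b := 2) (by norm_num) h
    have h2 : 0 < Nat.clog 2 n := Nat.clog_pos (by norm_num) h
    rw [← Nat.succ_pred_eq_of_pos h2, pow_succ]
    omega

lemma mul_netExponent_le {d : ℕ} (hd : 2 ≤ d) :
    ((d * netExponent d : ℕ) : ℝ) ≤ 40 * (d * Real.log d) := by
  have hd' : (2 : ℝ) ≤ d := by exact_mod_cast hd
  have hlog2 := Real.log_two_gt_d9
  have hlogd : Real.log 2 ≤ Real.log d := Real.log_le_log (by norm_num) hd'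
  have h1 : ((2 : ℝ) ^ Nat.clog 2 d) ≤ 2 * d := by
    exact_mod_cast two_pow_clog_le (by omega : 1 ≤ d)
  have h2 := Real.log_le_log (by positivity) h1
  rw [Real.log_pow, Real.log_mul (by norm_num) (by linarith)] at h2
  have h3 : (0 : ℝ) ≤ Nat.clog 2 d := Nat.cast_nonneg _
  have h4 : (netExponent d : ℝ) ≤ 40 * Real.log d := by
    rw [netExponent]
    push_cast
    have : (Nat.clog 2 d : ℝ) * 0.69 ≤ Nat.clog 2 d * Real.log 2 := by gcongr; linarith
    norm_num at this ⊢
    linarith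
  push_cast
  calc (d : ℝ) * netExponent d ≤ d * (40 * Real.log d) := by gcongr
    _ = _ := by ring

lemma topScale_le {d : ℕ} (hd : 2 ≤ d) {t : ℝ} (ht : 2 ≤ t) :
    (topScale d t : ℝ) ≤ 38 * Real.log (d * t) := by
  have hd' : (2 : ℝ) ≤ d := by exact_mod_cast hd
  have hlog2 := Real.log_two_gt_d9
  have hlogt : Real.log 2 ≤ Real.log t := Real.log_le_log (by norm_num) ht
  have hlogd : Real.log 2 ≤ Real.log d := Real.log_le_log (by norm_num) hd'
  have hE := mul_netExponent_le hd
  push_cast at hE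
  have hlogd' : Real.log d ≤ d - 1 := Real.log_le_sub_one_of_pos (by linarith)
  have hΛ : logBound d ≤ 81 * d ^ 2 := by
    rw [logBound]
    nlinarith
  have hA : 8 * slope d t + 1 ≤ 2 ^ 32 * (d ^ 3 * t) := by
    have e1 : 8 * slope d t ≤ 8 * (256 * 10 ^ 4 * d * t * (81 * d ^ 2)) := by
      rw [slope]; gcongr
    have e2 : (1 : ℝ) ≤ d ^ 3 * t :=
      one_le_mul_of_one_le_of_one_le (one_le_pow₀ (by linarith)) (by linarith)
    norm_num at e1 ⊢
    linarith
  have hA0 := slope_nonneg d (by linarith : 0 ≤ t)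
  have hceil : (⌈8 * slope d t⌉₊ : ℝ) ≤ 2 ^ 32 * (d ^ 3 * t) :=
    (Nat.ceil_lt_add_one (by linarith)).le.trans hA
  have hpow : (2 : ℝ) ^ topScale d t ≤ 2 ^ 33 * (d ^ 3 * t) := by
    rcases Nat.eq_zero_or_pos ⌈8 * slope d t⌉₊ with h0 | h0
    · rw [topScale, h0]
      have e2 : (1 : ℝ) ≤ d ^ 3 * t :=
        one_le_mul_of_one_le_of_one_le (one_le_pow₀ (by linarith)) (by linarith)
      norm_num
      linarith
    · have : (2 : ℝ) ^ topScale d t ≤ 2 * ⌈8 * slope d t⌉₊ := by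
        exact_mod_cast two_pow_clog_le h0
      calc _ ≤ _ := this
        _ ≤ 2 * (2 ^ 32 * (d ^ 3 * t)) := by gcongr
        _ = _ := by ring
  have h := Real.log_le_log (by positivity) hpow
  rw [Real.log_mul (by positivity) (by positivity), Real.log_mul (by positivity) (by positivity),
    Real.log_pow, Real.log_pow, Real.log_pow] at h
  rw [Real.log_mul (by linarith) (by linarith)]
  have hJ0 : (0 : ℝ) ≤ topScale d t := Nat.cast_nonneg _
  have : (topScale d t : ℝ) * 0.69 ≤ topScale d t * Real.log 2 := by gcongr; linarith
  have hlog2' := Real.log_two_lt_d9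
  norm_num at h this ⊢
  linarith

lemma cellBound_le {d : ℕ} (hd : 2 ≤ d) {t : ℝ} (ht : 2 ≤ t) :
    cellBound d t ≤ t ^ (6000 * (d * Real.log d * Real.log (d * t))) := by
  have hd' : (2 : ℝ) ≤ d := by exact_mod_cast hd
  have hlog2 := Real.log_two_gt_d9
  have hlog2' := Real.log_two_lt_d9
  have hlogt : Real.log 2 ≤ Real.log t := Real.log_le_log (by norm_num) ht
  have hlogd : Real.log 2 ≤ Real.log d := Real.log_le_log (by norm_num) hd'
  have hE := mul_netExponent_le hd
  have hJ := topScale_le hd ht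
  set E := d * netExponent d with hEdef
  set X := d * Real.log d with hX
  set Y := Real.log (d * t) with hY
  have hX1 : 1 ≤ X := by nlinarith
  have hY1 : 1 ≤ Y := by
    rw [hY, Real.log_mul (by linarith) (by linarith)]
    linarith
  have hE0 : (0 : ℝ) ≤ E := Nat.cast_nonneg _
  have hE2 : (E : ℝ) * Real.log 2 ≤ E := mul_le_of_le_one_right hE0 (by linarith)
  have hN : Real.log ((2 ^ E) ^ 2) ≤ 80 * X := by
    rw [Real.log_pow, Real.log_pow]
    push_cast
    linarith
  have hQ : Real.log (growth d) ≤ 95 * X := by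
    have h15 : Real.log (3 * 10 ^ 4) ≤ 15 := by
      have : Real.log (3 * 10 ^ 4) ≤ Real.log (2 ^ 15) :=
        Real.log_le_log (by norm_num) (by norm_num)
      rw [Real.log_pow] at this
      push_cast at this
      linarith
    rw [growth, ← hEdef, Real.log_mul (by norm_num) (by positivity)]
    linarith
  have hQ0 := one_le_growth d
  have hM0 := one_le_cellBound d t
  have hlogM : Real.log (cellBound d t) ≤ 3700 * (X * Y) := by
    have hXY : X ≤ X * Y := le_mul_of_one_le_right (by linarith) hY1
    have h8 : Real.log 8 ≤ 3 := by
      rw [show (8 : ℝ) = 2 ^ 3 by norm_num, Real.log_pow]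
      push_cast
      linarith
    have hJQ : (topScale d t : ℝ) * Real.log (growth d) ≤ 38 * Y * (95 * X) :=
      mul_le_mul hJ hQ (Real.log_nonneg hQ0) (by linarith)
    rw [cellBound, ← hEdef, Real.log_mul (by norm_num) (by positivity),
      Real.log_mul (by positivity) (by positivity), Real.log_pow (growth d)]
    linarith
  rw [← Real.exp_log (by linarith : 0 < cellBound d t), Real.rpow_def_of_pos (by linarith)]
  apply Real.exp_le_exp.2
  have hXY0 : 0 ≤ X * Y := by positivity
  calc Real.log (cellBound d t) ≤ 3700 * (X * Y) := hlogM
    _ ≤ 0.69 * (6000 * (X * Y)) := by linarith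
    _ ≤ Real.log t * (6000 * (X * Y)) := by gcongr; linarith

/-- Except with probability at most `1 / 4`, there are at most `cellBound` disjoint cells of radius
greater than `r` that meet the ball. -/
lemma choicesLaw_exceptional_le {D d : ℕ} (hd : 0 < d) {S : Finset (EuclideanSpace ℝ (Fin D))}
    (hS : DoublingDimLE (S : Set (EuclideanSpace ℝ (Fin D))) d)
    {pivot : List Bool → Finset (EuclideanSpace ℝ (Fin D)) → EuclideanSpace ℝ (Fin D)}
    (hpivot : ∀ (w : List Bool) (C : Finset (EuclideanSpace ℝ (Fin D))),
      C.Nonempty → pivot w C ∈ C)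
    {r : ℝ} (hr : 0 < r) (x : EuclideanSpace ℝ (Fin D)) {R : ℝ} (hR : 0 < R) :
    choicesLaw D {ω | 1 ≤ ∑' w, treeCost S pivot d r (Metric.closedBall x R) (R / r) ω w} ≤
      ENNReal.ofReal (1 / 4) := by
  obtain ⟨P⟩ := hS.nonempty_scalePotential hd hr
  have hmeas : Measurable fun ω : Choices D =>
      ∑' w, treeCost S pivot d r (Metric.closedBall x R) (R / r) ω w :=
    Measurable.tsum fun w => measurable_treeCost S pivot d r _ _ w
  have h := mul_meas_ge_le_lintegral (μ := choicesLaw D) hmeas 1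
  rw [one_mul] at h
  refine h.trans ((lintegral_tsum_treeCost_le S pivot hd hS hpivot P hr x hR).trans ?_)
  exact ENNReal.ofReal_le_ofReal
    (lyapunov_le_quarter P _ hr (by positivity) (Finset.Subset.refl S))

end RPTreeMax

theorem theorem3 :
    ∃ c : ℝ, 0 < c ∧
      ∀ (D d : ℕ) (S : Finset (EuclideanSpace ℝ (Fin D)))
        (pivot : List Bool → Finset (EuclideanSpace ℝ (Fin D)) → EuclideanSpace ℝ (Fin D))
        (x : EuclideanSpace ℝ (Fin D)) (R r : ℝ),
        2 ≤ d →
        RPTreeMax.DoublingDimLE (S : Set (EuclideanSpace ℝ (Fin D))) d →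
        (∀ (w : List Bool) (C : Finset (EuclideanSpace ℝ (Fin D))),
          C.Nonempty → pivot w C ∈ C) →
        0 < r →
        2 * r ≤ R →
        1 / 2 < RPTreeMax.choicesLaw D
          {ω : RPTreeMax.Choices D |
            ∀ F : Finset (List Bool),
              (∀ w ∈ F, r < RPTreeMax.radius (RPTreeMax.cell S pivot ω w) ∧
                ∃ z ∈ RPTreeMax.cell S pivot ω w, z ∈ Metric.closedBall x R) →
              (F : Set (List Bool)).PairwiseDisjoint (RPTreeMax.cell S pivot ω) →
              (F.card : ℝ) ≤
                (R / r) ^ (c * ((d : ℝ) * Real.log d * Real.log ((d : ℝ) * R / r)))} := by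
  refine ⟨6000, by norm_num, fun D d S pivot x R r hd hS hpivot hr hR => ?_⟩
  have hR0 : 0 < R := by linarith
  have ht : 2 ≤ R / r := by rwa [le_div_iff₀ hr]
  have hbad := RPTreeMax.choicesLaw_exceptional_le (by omega : 0 < d) hS hpivot hr x hR0
  set good : Set (RPTreeMax.Choices D) := {ω : RPTreeMax.Choices D |
            ∀ F : Finset (List Bool),
              (∀ w ∈ F, r < RPTreeMax.radius (RPTreeMax.cell S pivot ω w) ∧
                ∃ z ∈ RPTreeMax.cell S pivot ω w, z ∈ Metric.closedBall x R) →
              (F : Set (List Bool)).PairwiseDisjoint (RPTreeMax.cell S pivot ω) →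
              (F.card : ℝ) ≤
                (R / r) ^ (6000 * ((d : ℝ) * Real.log d * Real.log ((d : ℝ) * R / r)))} with hgood
  have hcompl : goodᶜ ⊆ {ω | 1 ≤ ∑' w,
      RPTreeMax.treeCost S pivot d r (Metric.closedBall x R) (R / r) ω w} := by
    intro ω hω
    by_contra hlt
    refine hω fun F hF hdisj => ?_
    refine (RPTreeMax.card_le_cellBound S pivot hr (not_le.1 hlt) hF hdisj).trans ?_
    rw [mul_div_assoc]
    exact RPTreeMax.cellBound_le hd ht
  have : IsProbabilityMeasure (RPTreeMax.choicesLaw D) := by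
    unfold RPTreeMax.choicesLaw; infer_instance
  -- Outer measures are enough: the measurability of the event is not needed.
  have hone : 1 ≤ RPTreeMax.choicesLaw D good + ENNReal.ofReal (1 / 4) := by
    calc (1 : ENNReal) = RPTreeMax.choicesLaw D Set.univ := measure_univ.symm
      _ = RPTreeMax.choicesLaw D (good ∪ goodᶜ) := by rw [Set.union_compl_self]
      _ ≤ RPTreeMax.choicesLaw D good + RPTreeMax.choicesLaw D goodᶜ := measure_union_le _ _
      _ ≤ _ := by gcongr; exact (measure_mono hcompl).trans hbad
  by_contra! hle
  have h2 := hone.trans (add_le_add_left hle _)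
  rw [show (1 / 2 : ENNReal) = ENNReal.ofReal (1 / 2) by
      rw [ENNReal.ofReal_div_of_pos two_pos]; simp,
    ← ENNReal.ofReal_add (by norm_num) (by norm_num), ← ENNReal.ofReal_one,
    ENNReal.ofReal_le_ofReal_iff (by norm_num)] at h2
  norm_num at h2
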